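/- Let $K$ be a field, let $X$ be a totally disconnected compact metrizable space, and let $T\colon X\to X$ be a homeomorphism. Let $C_K(X)$ be the algebra of locally constant functions $X\to K$, and let $\mathcal A=C_K(X)\rtimes_T\mathbb Z$ be the algebraic crossed product: the ring of finite formal sums $\sum_{i\in\mathbb Z} f_i t^i$ with $f_i\in C_K(X)$ and product determined by $t f=(f\circ T^{-1})\,t$. A Sylvester matrix rank function on a unital ring $R$ is a function $\mathrm{rk}$ assigning to each rectangular matrix over $R$ a nonnegative real number such that (a) $\mathrm{rk}(0)=0$ for every zero matrix and $\mathrm{rk}(1)=1$; (b) $\mathrm{rk}(M_1M_2)\le \mathrm{rk}(M_1)$ and $\mathrm{rk}(M_1M_2)\le\mathrm{rk}(M_2)$ whenever the product is defined; (c) $\mathrm{rk}\begin{pmatrix}M_1&0\\0&M_2\end{pmatrix}=\mathrm{rk}(M_1)+\mathrm{rk}(M_2)$; (d) $\mathrm{rk}\begin{pmatrix}M_1&M_3\\0&M_2\end{pmatrix}\ge\mathrm{rk}(M_1)+\mathrm{rk}(M_2)$. Let $\mathbb P(R)$ be the convex set of all Sylvester matrix rank functions on $R$. Let $\mathbb P_{\mathrm{reg}}(R)\subseteq\mathbb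 P(R)$ be the set of those $\mathrm{rk}$ for which there are a von Neumann regular ring $S$ with a rank function $\mathrm{rk}_S$ and a ring homomorphism $\varphi\colon R\to S$ such that $\mathrm{rk}(M)=\mathrm{rk}_S(\varphi(M))$ for every matrix $M$ over $R$. Here a rank function on $S$ is a function $\mathrm{rk}_S\colon S\to[0,1]$ with $\mathrm{rk}_S(1)=1$, $\mathrm{rk}_S(x)=0$ if and only if $x=0$, $\mathrm{rk}_S(xy)\le \mathrm{rk}_S(x)$ and $\mathrm{rk}_S(xy)\le\mathrm{rk}_S(y)$ for all $x,y$, and $\mathrm{rk}_S(e+f)=\mathrm{rk}_S(e)+\mathrm{rk}_S(f)$ for orthogonal idempotents $e,f$; on matrices over $S$, $\mathrm{rk}_S$ denotes its unique extension to a Sylvester matrix rank function on $S$. Then for every extreme point $\mu$ of the convex set of $T$-invariant Borel probability measures on $X$ (equivalently, every ergodic $T$-invariant Borel probability measure $\mu$ on $X$), there exists an extreme point $\mathrm{rk}$ of $\mathbb P(\mathcal A)$ which belongs to $\mathbb P_{\mathrm{reg}}(\mathcal A)$ and satisfies $\mathrm{rk}(\chi_U)=\mu(U)$ for every clopen subset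 $U$ of $X$. -/

import Mathlib

open MeasureTheory
open scoped ENNReal

noncomputable section

/-! ### Sylvester matrix rank functions -/

/-- Real-valued functions on the rectangular matrices of all sizes over `R`. It is a real vector
space under pointwise operations. -/
abbrev MatrixFunction (R : Type*) : Type _ :=
  ∀ m n : ℕ, Matrix (Fin m) (Fin n) R → ℝ

/-- The block matrix with rows `(M₁ M₃)` and `(0 M₂)`. -/
def blockUpper {R : Type*} [Zero R] {m n p q : ℕ} (M₁ : Matrix (Fin m) (Fin n) R)
    (M₃ : Matrix (Fin m) (Fin q) R) (M₂ : Matrix (Fin p) (Fin q) R) :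
    Matrix (Fin (m + p)) (Fin (n + q)) R :=
  (Matrix.fromBlocks M₁ M₃ 0 M₂).reindex finSumFinEquiv finSumFinEquiv

/-- Sylvester matrix rank functions on a unital ring. -/
structure IsSylvesterRank {R : Type*} [Ring R] (rk : MatrixFunction R) : Prop where
  nonneg : ∀ (m n : ℕ) (M : Matrix (Fin m) (Fin n) R), 0 ≤ rk m n M
  zero : ∀ m n : ℕ, rk m n 0 = 0
  one : rk 1 1 1 = 1
  mul_le_left : ∀ (m n p : ℕ) (M₁ : Matrix (Fin m) (Fin n) R) (M₂ : Matrix (Fin n) (Fin p) R),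
    rk m p (M₁ * M₂) ≤ rk m n M₁
  mul_le_right : ∀ (m n p : ℕ) (M₁ : Matrix (Fin m) (Fin n) R) (M₂ : Matrix (Fin n) (Fin p) R),
    rk m p (M₁ * M₂) ≤ rk n p M₂
  diag : ∀ (m n p q : ℕ) (M₁ : Matrix (Fin m) (Fin n) R) (M₂ : Matrix (Fin p) (Fin q) R),
    rk (m + p) (n + q) (blockUpper M₁ 0 M₂) = rk m n M₁ + rk p q M₂
  upper : ∀ (m n p q : ℕ) (M₁ : Matrix (Fin m) (Fin n) R) (M₃ : Matrix (Fin m) (Fin q) R)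
    (M₂ : Matrix (Fin p) (Fin q) R),
    rk m n M₁ + rk p q M₂ ≤ rk (m + p) (n + q) (blockUpper M₁ M₃ M₂)

/-- The convex set `ℙ(R)` of all Sylvester matrix rank functions on `R`. -/
def sylvesterRanks (R : Type*) [Ring R] : Set (MatrixFunction R) :=
  {rk | IsSylvesterRank rk}

/-! ### Regular rank rings -/

/-- Von Neumann regular rings. -/
def IsVonNeumannRegular (S : Type*) [Ring S] : Prop :=
  ∀ x : S, ∃ y : S, x = x * y * x

/-- Rank functions on a (regular) ring: `[0,1]`-valued pseudo-rank functions vanishing only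
at `0`. -/
structure IsRankFunction {S : Type*} [Ring S] (ρ : S → ℝ) : Prop where
  mem_Icc : ∀ x, ρ x ∈ Set.Icc (0 : ℝ) 1
  map_zero : ρ 0 = 0
  map_one : ρ 1 = 1
  mul_le_left : ∀ x y, ρ (x * y) ≤ ρ x
  mul_le_right : ∀ x y, ρ (x * y) ≤ ρ y
  add_of_orthogonal : ∀ e f : S, e * e = e → f * f = f → e * f = 0 → f * e = 0 →
    ρ (e + f) = ρ e + ρ f
  eq_zero : ∀ x, ρ x = 0 → x = 0

/-- The set `ℙ_reg(R)`: Sylvester matrix rank functions pulled back along a ring homomorphism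
`φ : R → S` from a regular ring `S` with a rank function `ρ`. The value of `ρ` on matrices over `S`
is that of its (unique) extension `σ` to a Sylvester matrix rank function on `S`.

Requiring `S` to be in the universe of `R` is harmless: `S` may be replaced by a regular subring
containing the image of `R` and having cardinality at most that of `R` or `ℵ₀`. -/
def regularSylvesterRanks.{u} (R : Type u) [Ring R] : Set (MatrixFunction R) :=
  {rk | IsSylvesterRank rk ∧ ∃ (S : Type u) (_ : Ring S) (ρ : S → ℝ) (σ : MatrixFunction S)
    (φ : R →+* S), IsVonNeumannRegular S ∧ IsRankFunction ρ ∧ IsSylvesterRank σ ∧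
      (∀ x : S, σ 1 1 !![x] = ρ x) ∧
      ∀ (m n : ℕ) (M : Matrix (Fin m) (Fin n) R), rk m n M = σ m n (M.map φ)}

/-! ### The crossed product -/

/-- The action of `ℤ` on a ring `A` through the powers of an automorphism `α`. -/
abbrev automorphismAction {A : Type*} [Ring A] (α : RingAut A) :
    MulSemiringAction (Multiplicative ℤ) A :=
  MulSemiringAction.compHom A (zpowersHom (RingAut A) α)

/-- The algebraic crossed product `A ⋊_α ℤ`: finite formal sums `∑ aᵢ tⁱ`, with
`(a tⁱ) (b tʲ) = a αⁱ(b) tⁱ⁺ʲ`. The term `a tⁱ` is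
`SkewMonoidAlgebra.single (Multiplicative.ofAdd i) a`. -/
def CrossedProduct {A : Type*} [Ring A] (_α : RingAut A) : Type _ :=
  SkewMonoidAlgebra A (Multiplicative ℤ)

instance CrossedProduct.instRing {A : Type*} [Ring A] (α : RingAut A) :
    Ring (CrossedProduct α) :=
  letI := automorphismAction α
  inferInstanceAs (Ring (SkewMonoidAlgebra A (Multiplicative ℤ)))

/-- The canonical embedding `A → A ⋊_α ℤ`, `a ↦ a t⁰`. -/
def CrossedProduct.incl {A : Type*} [Ring A] (α : RingAut A) : A →+* CrossedProduct α :=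
  letI := automorphismAction α
  (SkewMonoidAlgebra.singleOneRingHom : A →+* SkewMonoidAlgebra A (Multiplicative ℤ))

/-- The automorphism `b ↦ b ∘ T⁻¹` of the algebra `C_K(X)` of locally constant functions. -/
def homeoAutomorphism (K : Type*) [Field K] {X : Type*} [TopologicalSpace X] (T : X ≃ₜ X) :
    RingAut (LocallyConstant X K) :=
  LocallyConstant.congrLeftRingEquiv T

/-- The crossed product `C_K(X) ⋊_T ℤ`. -/
abbrev DynCrossedProduct (K : Type*) [Field K] {X : Type*} [TopologicalSpace X] (T : X ≃ₜ X) :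
    Type _ :=
  CrossedProduct (homeoAutomorphism K T)

/-- The characteristic function `χ_U` of a clopen set, as an element of `C_K(X) ⋊_T ℤ`. -/
def chi (K : Type*) [Field K] {X : Type*} [TopologicalSpace X] (T : X ≃ₜ X) {U : Set X}
    (hU : IsClopen U) : DynCrossedProduct K T :=
  CrossedProduct.incl (homeoAutomorphism K T) (LocallyConstant.charFn K hU)

/-! ### Invariant measures -/

/-- The convex set of `T`-invariant Borel probability measures. -/
def invariantProbabilityMeasures {X : Type*} [TopologicalSpace X] [MeasurableSpace X]
    (T : X ≃ₜ X) : Set (Measure X) :=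
  {μ | MeasurePreserving T μ μ ∧ IsProbabilityMeasure μ}

end

/-! Let an element of the crossed product act on the functions on an orbit: `f tᵏ` shifts by `k` and
multiplies by the values of `f`. Compressing to the segment `x, Tx, …, Tᴺx` gives an (N+1)×(N+1)
matrix over `K`. `measureRank` is the normalized rank of this matrix, averaged over `x` with respect
to `μ`, in the limit along a nonprincipal ultrafilter in `N`.

Compression of monomials is multiplicative up to boundary rows, whose proportion tends to zero
(`rank_compress_mul_sub_le`). Modulo elements of rank zero it is therefore a ring homomorphism into
a quotient of a product of regular rings, and the rank function is regular
(`mem_regularSylvesterRanks`). By invariance of `μ` its value on `χ_U` is `μ(U)`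
(`measureRank_chi`).

For extremality, write `measureRank` as a proper convex combination of two rank functions. Each
restricts to an invariant measure on clopen sets, so extremality of `μ` makes both measures equal to
`μ` (`eltRank_chi_eq_of_extremePoint`). Moreover `measureRank` has the maximal value 1 on every
nonzero Laurent polynomial in `tᵖ` (`eltRank_measureRank_cyclicHom`), and a maximal value is
inherited by both summands. These data determine a rank function (`rank_unique_of_ergodic`), by a
dichotomy at a point of the support of `μ`.

If the point has measure zero, there are towers over clopen bases of arbitrarily small measure. Up
to an error controlled by the base, a matrix can be cut along the levels into one over the
commutative ring `C_K(X)`, where ranks are determined by the idempotents `χ_U`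
(`rank_unique_of_small_sections`). If it is an atom, `μ` lives on a periodic orbit of some length
`p`, and cutting leads to matrices over the domain `K[t, t⁻¹]`, with `t` mapped to `tᵖ`
(`rank_unique_of_periodic`). Here `μ` alone does not suffice: over a single point, evaluations `K[t,
t⁻¹] → K` give further rank functions. Full rank on nonzero polynomials singles out the rank over
the fraction field. -/

noncomputable section

/-! ### Rank functions on matrices with arbitrary finite index types -/

/-- The value of a matrix function on a matrix indexed by finite types. -/
def fval {R : Type*} (rk : MatrixFunction R) {ι κ : Type*} [Fintype ι] [Fintype κ]
    (M : Matrix ι κ R) : ℝ :=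
  rk (Fintype.card ι) (Fintype.card κ)
    (M.submatrix (Fintype.equivFin ι).symm (Fintype.equivFin κ).symm)

namespace IsSylvesterRank

open Matrix

variable {R : Type*} [Ring R] {rk : MatrixFunction R}
  {ι κ l ι' κ' : Type*} [Fintype ι] [Fintype κ] [Fintype l] [Fintype ι'] [Fintype κ']

/-- Selecting rows and columns, possibly with repetition, is multiplication by 0-1 matrices. -/
theorem submatrix_le (h : IsSylvesterRank rk) {m n m' n' : ℕ} (M : Matrix (Fin m) (Fin n) R)
    (a : Fin m' → Fin m) (b : Fin n' → Fin n) : rk m' n' (M.submatrix a b) ≤ rk m n M := by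
  have : M.submatrix a b = (1 : Matrix (Fin m) (Fin m) R).submatrix a id *
      (M * (1 : Matrix (Fin n) (Fin n) R).submatrix id b) := by
    ext i j
    simp [Matrix.mul_apply, Matrix.one_apply]
  rw [this]
  exact (h.mul_le_right _ _ _ _ _).trans (h.mul_le_left _ _ _ _ _)

/-- Makes `fval` independent of the enumerations chosen in its definition. -/
theorem fval_eq (h : IsSylvesterRank rk) {m n : ℕ} (e : Fin m ≃ ι) (f : Fin n ≃ κ)
    (M : Matrix ι κ R) : fval rk M = rk m n (M.submatrix e f) := by
  apply le_antisymm
  · have := h.submatrix_le (M.submatrix e f) (fun i => e.symm ((Fintype.equivFin ι).symm i))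
      (fun i => f.symm ((Fintype.equivFin κ).symm i))
    simpa [fval, Matrix.submatrix_submatrix, Function.comp_def] using this
  · have := h.submatrix_le (M.submatrix (Fintype.equivFin ι).symm (Fintype.equivFin κ).symm)
      (fun i => (Fintype.equivFin ι) (e i)) (fun i => (Fintype.equivFin κ) (f i))
    simpa [fval, Matrix.submatrix_submatrix, Function.comp_def] using this

theorem fval_fin (h : IsSylvesterRank rk) {m n : ℕ} (M : Matrix (Fin m) (Fin n) R) :
    fval rk M = rk m n M :=
  h.fval_eq (Equiv.refl _) (Equiv.refl _) M

theorem fval_zero (h : IsSylvesterRank rk) : fval rk (0 : Matrix ι κ R) = 0 :=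
  h.zero _ _

theorem fval_mul_le_left (h : IsSylvesterRank rk) (M : Matrix ι κ R) (N : Matrix κ l R) :
    fval rk (M * N) ≤ fval rk M := by
  have := h.mul_le_left _ _ _
    (M.submatrix (Fintype.equivFin ι).symm (Fintype.equivFin κ).symm)
    (N.submatrix (Fintype.equivFin κ).symm (Fintype.equivFin l).symm)
  rwa [Matrix.submatrix_mul_equiv] at this

theorem fval_mul_le_right (h : IsSylvesterRank rk) (M : Matrix ι κ R) (N : Matrix κ l R) :
    fval rk (M * N) ≤ fval rk N := by
  have := h.mul_le_right _ _ _
    (M.submatrix (Fintype.equivFin ι).symm (Fintype.equivFin κ).symm)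
    (N.submatrix (Fintype.equivFin κ).symm (Fintype.equivFin l).symm)
  rwa [Matrix.submatrix_mul_equiv] at this

theorem fval_submatrix_le (h : IsSylvesterRank rk) (M : Matrix ι κ R) (a : ι' → ι) (b : κ' → κ) :
    fval rk (M.submatrix a b) ≤ fval rk M := by
  have := h.submatrix_le (M.submatrix (Fintype.equivFin ι).symm (Fintype.equivFin κ).symm)
    (fun i => Fintype.equivFin ι (a ((Fintype.equivFin ι').symm i)))
    (fun i => Fintype.equivFin κ (b ((Fintype.equivFin κ').symm i)))
  simpa [fval, Matrix.submatrix_submatrix, Function.comp_def] using this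

theorem fval_submatrix_equiv (h : IsSylvesterRank rk) (M : Matrix ι κ R) (e : ι' ≃ ι)
    (f : κ' ≃ κ) : fval rk (M.submatrix e f) = fval rk M := by
  apply le_antisymm (h.fval_submatrix_le M e f)
  simpa [Matrix.submatrix_submatrix] using h.fval_submatrix_le (M.submatrix e f) e.symm f.symm

theorem fval_fromBlocks (h : IsSylvesterRank rk) (A : Matrix ι κ R) (B : Matrix ι κ' R)
    (D : Matrix ι' κ' R) :
    fval rk (fromBlocks A B 0 D) = rk (Fintype.card ι + Fintype.card ι')
      (Fintype.card κ + Fintype.card κ')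
      (blockUpper (A.submatrix (Fintype.equivFin ι).symm (Fintype.equivFin κ).symm)
        (B.submatrix (Fintype.equivFin ι).symm (Fintype.equivFin κ').symm)
        (D.submatrix (Fintype.equivFin ι').symm (Fintype.equivFin κ').symm)) := by
  rw [h.fval_eq (finSumFinEquiv.symm.trans
      ((Fintype.equivFin ι).symm.sumCongr (Fintype.equivFin ι').symm))
    (finSumFinEquiv.symm.trans ((Fintype.equivFin κ).symm.sumCongr (Fintype.equivFin κ').symm))]
  congr 1
  ext i j
  simp only [blockUpper, Matrix.reindex_apply, Matrix.submatrix_apply, Equiv.trans_apply]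
  rcases finSumFinEquiv.symm i with i | i <;> rcases finSumFinEquiv.symm j with j | j <;> simp

theorem fval_diag (h : IsSylvesterRank rk) (A : Matrix ι κ R) (D : Matrix ι' κ' R) :
    fval rk (fromBlocks A 0 0 D) = fval rk A + fval rk D := by
  rw [h.fval_fromBlocks]
  exact h.diag _ _ _ _ _ _

theorem fval_upper (h : IsSylvesterRank rk) (A : Matrix ι κ R) (B : Matrix ι κ' R)
    (D : Matrix ι' κ' R) : fval rk A + fval rk D ≤ fval rk (fromBlocks A B 0 D) := by
  rw [h.fval_fromBlocks]
  exact h.upper _ _ _ _ _ _ _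

theorem fval_add_le (h : IsSylvesterRank rk) (M N : Matrix ι κ R) :
    fval rk (M + N) ≤ fval rk M + fval rk N := by
  classical
  -- The sum factors through the direct sum of `M` and `N`.
  have : M + N = (fromCols 1 1 : Matrix ι (ι ⊕ ι) R) *
      (fromBlocks M 0 0 N * (fromRows 1 1 : Matrix (κ ⊕ κ) κ R)) := by
    simp [fromBlocks_mul_fromRows, fromCols_mul_fromRows]
  rw [← h.fval_diag, this]
  exact (h.fval_mul_le_right _ _).trans (h.fval_mul_le_left _ _)

theorem fval_neg (h : IsSylvesterRank rk) (M : Matrix ι κ R) : fval rk (-M) = fval rk M := by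
  classical
  have key : ∀ N : Matrix ι κ R, fval rk (-N) ≤ fval rk N := fun N => by
    have : -N = (-1 : Matrix ι ι R) * N := by simp
    rw [this]
    exact h.fval_mul_le_right _ _
  exact le_antisymm (key M) (by simpa using key (-M))

theorem abs_fval_sub_le (h : IsSylvesterRank rk) (M N : Matrix ι κ R) :
    |fval rk M - fval rk N| ≤ fval rk (M - N) := by
  have h1 := h.fval_add_le (M - N) N
  have h2 := h.fval_add_le (-(M - N)) M
  rw [h.fval_neg] at h2
  simp only [sub_add_cancel, neg_sub] at h1 h2
  exact abs_le.2 ⟨by linarith, by linarith⟩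

theorem fval_sum_le (h : IsSylvesterRank rk) {α : Type*} (s : Finset α) (M : α → Matrix ι κ R) :
    fval rk (∑ a ∈ s, M a) ≤ ∑ a ∈ s, fval rk (M a) := by
  classical
  induction s using Finset.induction_on with
  | empty => simp [h.fval_zero]
  | insert a s ha ih =>
    rw [Finset.sum_insert ha, Finset.sum_insert ha]
    exact (h.fval_add_le _ _).trans (by gcongr)

/-- The rank of a single element of the ring. -/
abbrev _root_.eltRank (rk : MatrixFunction R) (a : R) : ℝ := rk 1 1 !![a]

theorem eltRank_eq_fval (h : IsSylvesterRank rk) (a : R) :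
    eltRank rk a = fval rk (Matrix.of fun (_ _ : Unit) => a) := by
  rw [h.fval_eq (Equiv.ofUnique (Fin 1) Unit) (Equiv.ofUnique (Fin 1) Unit)]
  simp only [eltRank]
  congr 1
  ext i j
  fin_cases i; fin_cases j; rfl

theorem eltRank_nonneg (h : IsSylvesterRank rk) (a : R) : 0 ≤ eltRank rk a := h.nonneg _ _ _

theorem eltRank_zero (h : IsSylvesterRank rk) : eltRank rk (0 : R) = 0 := by
  rw [h.eltRank_eq_fval]; exact h.fval_zero

theorem eltRank_one (h : IsSylvesterRank rk) : eltRank rk (1 : R) = 1 := by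
  rw [← h.one]
  simp only [eltRank]
  congr 1
  ext i j
  fin_cases i; fin_cases j; rfl

theorem eltRank_mul_le_left (h : IsSylvesterRank rk) (a b : R) :
    eltRank rk (a * b) ≤ eltRank rk a := by
  have : !![a * b] = !![a] * !![b] := by ext i j; fin_cases i; fin_cases j; simp
  rw [eltRank, this]
  exact h.mul_le_left _ _ _ _ _

theorem eltRank_mul_le_right (h : IsSylvesterRank rk) (a b : R) :
    eltRank rk (a * b) ≤ eltRank rk b := by
  have : !![a * b] = !![a] * !![b] := by ext i j; fin_cases i; fin_cases j; simp
  rw [eltRank, this]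
  exact h.mul_le_right _ _ _ _ _

theorem eltRank_le_one (h : IsSylvesterRank rk) (a : R) : eltRank rk a ≤ 1 := by
  simpa [h.eltRank_one] using h.eltRank_mul_le_left 1 a

theorem eltRank_add_le (h : IsSylvesterRank rk) (a b : R) :
    eltRank rk (a + b) ≤ eltRank rk a + eltRank rk b := by
  simp only [h.eltRank_eq_fval]
  exact h.fval_add_le _ _

theorem eltRank_neg (h : IsSylvesterRank rk) (a : R) : eltRank rk (-a) = eltRank rk a := by
  simp only [h.eltRank_eq_fval]
  exact h.fval_neg _

/-- A matrix with one nonzero entry factors through a 1×1 matrix. With `abs_fval_sub_le` this turns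
entrywise approximation into approximation of ranks. -/
theorem fval_le_sum_eltRank (h : IsSylvesterRank rk) (M : Matrix ι κ R) :
    fval rk M ≤ ∑ i, ∑ j, eltRank rk (M i j) := by
  classical
  conv_lhs => rw [Matrix.matrix_eq_sum_single M]
  refine (h.fval_sum_le _ _).trans (Finset.sum_le_sum fun i _ => ?_)
  refine (h.fval_sum_le _ _).trans (Finset.sum_le_sum fun j _ => ?_)
  have : Matrix.single i j (M i j) = (Matrix.of fun i' (_ : Unit) => if i' = i then (1 : R) else 0) *
      ((Matrix.of fun (_ _ : Unit) => M i j) *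
      (Matrix.of fun (_ : Unit) j' => if j' = j then (1 : R) else 0)) := by
    ext a b
    simp only [Matrix.single, Matrix.mul_apply, Matrix.of_apply]
    by_cases ha : i = a <;> by_cases hb : j = b <;> simp [ha, hb, eq_comm]
  rw [this, h.eltRank_eq_fval]
  exact (h.fval_mul_le_right _ _).trans (h.fval_mul_le_left _ _)

theorem fval_congr_of_eltRank_sub (h : IsSylvesterRank rk) {M N : Matrix ι κ R}
    (hMN : ∀ i j, eltRank rk (M i j - N i j) = 0) : fval rk M = fval rk N := by
  have h1 := (h.abs_fval_sub_le M N).trans (h.fval_le_sum_eltRank (M - N))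
  simp only [Matrix.sub_apply, hMN, Finset.sum_const_zero] at h1
  exact sub_eq_zero.1 (abs_nonpos_iff.1 h1)

theorem eltRank_add_of_orthogonal (h : IsSylvesterRank rk) {e f : R} (he : e * e = e)
    (hf : f * f = f) (hef : e * f = 0) (hfe : f * e = 0) :
    eltRank rk (e + f) = eltRank rk e + eltRank rk f := by
  apply le_antisymm (h.eltRank_add_le e f)
  simp only [h.eltRank_eq_fval]
  rw [← h.fval_diag]
  -- Orthogonality makes `diag(e, f)` the product of the column `(e, f)`, the element `e + f` and
  -- the row `(e, f)`.
  have : fromBlocks (Matrix.of fun (_ _ : Unit) => e) 0 0 (Matrix.of fun (_ _ : Unit) => f) =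
      fromRows (Matrix.of fun (_ _ : Unit) => e) (Matrix.of fun (_ _ : Unit) => f) *
      ((Matrix.of fun (_ _ : Unit) => e + f) *
      fromCols (Matrix.of fun (_ _ : Unit) => e) (Matrix.of fun (_ _ : Unit) => f)) := by
    rw [mul_fromCols, fromRows_mul_fromCols]
    ext (i | i) (j | j) <;>
      simp [Matrix.mul_apply, add_mul, he, hf, hef, hfe]
  rw [this]
  exact (h.fval_mul_le_right _ _).trans (h.fval_mul_le_left _ _)

/-- The decomposition `α × Fin (n + 1) ≃ α ⊕ α × Fin n`. -/
def _root_.sumProdFinEquiv (α : Type*) (n : ℕ) : α ⊕ (α × Fin n) ≃ α × Fin (n + 1) where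
  toFun := Sum.elim (fun a => (a, 0)) (fun p => (p.1, p.2.succ))
  invFun p := Fin.cases (Sum.inl p.1) (fun k => Sum.inr (p.1, k)) p.2
  left_inv := by rintro (a | ⟨a, k⟩) <;> simp
  right_inv := by rintro ⟨a, k⟩; refine Fin.cases ?_ (fun k => ?_) k <;> simp

theorem fval_blockDiagonal (h : IsSylvesterRank rk) {o : Type*} [Fintype o] [DecidableEq o]
    (M : o → Matrix ι κ R) : fval rk (blockDiagonal M) = ∑ k, fval rk (M k) := by
  have main : ∀ (n : ℕ) (M : Fin n → Matrix ι κ R),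
      fval rk (blockDiagonal M) = ∑ k, fval rk (M k) := by
    intro n
    induction n with
    | zero =>
      intro M
      have : blockDiagonal M = 0 := by ext ⟨_, k⟩; exact k.elim0
      simp [this, h.fval_zero]
    | succ n ih =>
      intro M
      rw [Fin.sum_univ_succ, ← ih, ← h.fval_diag]
      rw [← h.fval_submatrix_equiv (blockDiagonal M) (sumProdFinEquiv ι n) (sumProdFinEquiv κ n)]
      congr 1
      ext (i | ⟨i, k⟩) (j | ⟨j, k'⟩)
      · simp [sumProdFinEquiv, blockDiagonal_apply]
      · simp [sumProdFinEquiv, blockDiagonal_apply, (Fin.succ_ne_zero k').symm]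
      · simp [sumProdFinEquiv, blockDiagonal_apply]
      · simp [sumProdFinEquiv, blockDiagonal_apply]
  let e := Fintype.equivFin o
  rw [← h.fval_submatrix_equiv (blockDiagonal M) ((Equiv.refl ι).prodCongr e.symm)
    ((Equiv.refl κ).prodCongr e.symm), ← e.symm.sum_comp, ← main]
  congr 1
  ext ⟨i, k⟩ ⟨j, k'⟩
  simp [blockDiagonal_apply]

theorem fval_diagonal (h : IsSylvesterRank rk) [DecidableEq ι] (d : ι → R) :
    fval rk (diagonal d) = ∑ i, eltRank rk (d i) := by
  have h1 := h.fval_blockDiagonal (fun i => Matrix.of fun (_ _ : Unit) => d i)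
  simp only [← h.eltRank_eq_fval] at h1
  rw [← h1, ← h.fval_submatrix_equiv _ (Equiv.punitProd ι).symm (Equiv.punitProd ι).symm]
  congr 1

theorem fval_one (h : IsSylvesterRank rk) [DecidableEq ι] :
    fval rk (1 : Matrix ι ι R) = Fintype.card ι := by
  rw [← diagonal_one, h.fval_diagonal]
  simp only [h.eltRank_one]
  simp

theorem le_card (h : IsSylvesterRank rk) (m n : ℕ) (M : Matrix (Fin m) (Fin n) R) :
    rk m n M ≤ m := by
  have := h.fval_mul_le_left (1 : Matrix (Fin m) (Fin m) R) M
  rwa [Matrix.one_mul, h.fval_one, h.fval_fin, Fintype.card_fin] at this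

/-- Sylvester's inequality. -/
theorem fval_add_fval_le (h : IsSylvesterRank rk) [DecidableEq κ] (A : Matrix ι κ R)
    (B : Matrix κ l R) : fval rk A + fval rk B ≤ fval rk (A * B) + Fintype.card κ := by
  classical
  have h1 := h.fval_upper B 1 A
  -- Block row and column operations carry `diag(-AB, 1)` to a triangular matrix with diagonal
  -- blocks `B` and `A`, to which axiom (d) applies.
  have h2 : fromBlocks B 1 0 A = (fromBlocks 0 1 1 A : Matrix (κ ⊕ ι) (ι ⊕ κ) R) *
      (fromBlocks (-(A * B)) 0 0 (1 : Matrix κ κ R) *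
        (fromBlocks 1 0 B 1 : Matrix (l ⊕ κ) (l ⊕ κ) R)) := by
    simp [fromBlocks_multiply]
  rw [h2] at h1
  have h3 := (h1.trans (h.fval_mul_le_right _ _)).trans (h.fval_mul_le_left _ _)
  rw [h.fval_diag, h.fval_neg, h.fval_one] at h3
  linarith

/-- Multiplication by a matrix of full rank does not change the rank. -/
theorem fval_mul_of_full_left (h : IsSylvesterRank rk) [DecidableEq κ] {A : Matrix ι κ R}
    (hA : fval rk A = Fintype.card κ) (B : Matrix κ l R) : fval rk (A * B) = fval rk B := by
  have := h.fval_add_fval_le A B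
  exact le_antisymm (h.fval_mul_le_right _ _) (by linarith)

theorem fval_mul_of_full_right (h : IsSylvesterRank rk) [DecidableEq κ] (A : Matrix ι κ R)
    {B : Matrix κ l R} (hB : fval rk B = Fintype.card κ) : fval rk (A * B) = fval rk A := by
  have := h.fval_add_fval_le A B
  exact le_antisymm (h.fval_mul_le_left _ _) (by linarith)

theorem fval_eq_of_mul_eq (h : IsSylvesterRank rk) {M : Matrix ι κ R} {N : Matrix ι' κ' R}
    (P : Matrix ι' ι R) (Q : Matrix κ κ' R) (P' : Matrix ι ι' R) (Q' : Matrix κ' κ R)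
    (hN : P * M * Q = N) (hM : P' * N * Q' = M) : fval rk M = fval rk N := by
  apply le_antisymm
  · rw [← hM]
    exact (h.fval_mul_le_left _ _).trans (h.fval_mul_le_right _ _)
  · rw [← hN]
    exact (h.fval_mul_le_left _ _).trans (h.fval_mul_le_right _ _)

/-- Two rank functions agree if they agree on all square matrices. -/
theorem ext_of_square {rk' : MatrixFunction R} (h : IsSylvesterRank rk) (h' : IsSylvesterRank rk')
    (H : ∀ (n : ℕ) (M : Matrix (Fin n) (Fin n) R), rk n n M = rk' n n M) : rk = rk' := by
  funext m n M
  -- A rectangular matrix padded with zeros to a square one keeps its rank.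
  have key : ∀ {σ : MatrixFunction R}, IsSylvesterRank σ →
      σ m n M = fval σ (fromBlocks 0 M 0 0 : Matrix (Fin m ⊕ Fin n) (Fin m ⊕ Fin n) R) := by
    intro σ hσ
    rw [← hσ.fval_fin]
    refine hσ.fval_eq_of_mul_eq (fromRows 1 0) (fromCols 0 1) (fromCols 1 0) (fromRows 0 1) ?_ ?_
    · rw [fromRows_mul, fromRows_mul_fromCols]
      simp
    · rw [fromCols_mul_fromBlocks, fromCols_mul_fromRows]
      simp
  rw [key h, key h']
  exact H _ _

/-- The pullback of a rank function along a ring homomorphism. -/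
theorem pullback {S : Type*} [Ring S] {σ : MatrixFunction S} (h : IsSylvesterRank σ)
    (φ : R →+* S) : IsSylvesterRank (fun m n (M : Matrix (Fin m) (Fin n) R) => σ m n (M.map φ)) where
  nonneg _ _ _ := h.nonneg _ _ _
  zero m n := by simpa using h.zero m n
  one := by simpa using h.one
  mul_le_left m n p M N := by rw [Matrix.map_mul]; exact h.mul_le_left _ _ _ _ _
  mul_le_right m n p M N := by rw [Matrix.map_mul]; exact h.mul_le_right _ _ _ _ _
  diag m n p q M N := by
    rw [← h.diag]
    congr 1
    simp [blockUpper, ← Matrix.submatrix_map, Matrix.fromBlocks_map]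
  upper m n p q M B N := by
    convert h.upper m n p q (M.map φ) (B.map φ) (N.map φ) using 2
    simp [blockUpper, ← Matrix.submatrix_map, Matrix.fromBlocks_map]

theorem fval_pullback {S : Type*} [Ring S] (σ : MatrixFunction S) (φ : R →+* S)
    (M : Matrix ι κ R) :
    fval (fun m n (M : Matrix (Fin m) (Fin n) R) => σ m n (M.map φ)) M = fval σ (M.map φ) := rfl

theorem eltRank_pullback {S : Type*} [Ring S] (σ : MatrixFunction S) (φ : R →+* S) (a : R) :
    eltRank (fun m n (M : Matrix (Fin m) (Fin n) R) => σ m n (M.map φ)) a = eltRank σ (φ a) := by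
  simp only [eltRank]
  congr 1
  ext i j
  fin_cases i; fin_cases j; rfl

end IsSylvesterRank

end

noncomputable section

/-! ### Constructions of rank functions -/

open Matrix Filter Topology

/-- Project the column space of the block matrix to the lower coordinates: the image contains the
column space of `D`, and the kernel contains a copy of that of `A`. Rank-nullity concludes. -/
theorem rank_add_rank_le_rank_fromBlocks {K : Type*} [Field K] {ι κ ι' κ' : Type*} [Fintype ι]
    [Fintype κ] [Fintype ι'] [Fintype κ'] (A : Matrix ι κ K) (B : Matrix ι κ' K)
    (D : Matrix ι' κ' K) : A.rank + D.rank ≤ (fromBlocks A B 0 D).rank := by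
  classical
  set M := fromBlocks A B 0 D with hM
  let V := LinearMap.range M.mulVecLin
  let π : (ι ⊕ ι' → K) →ₗ[K] (ι' → K) := LinearMap.funLeft K K Sum.inr
  let f : V →ₗ[K] (ι' → K) := π.comp V.subtype
  have h1 := LinearMap.finrank_range_add_finrank_ker f
  have h2 : D.rank ≤ Module.finrank K (LinearMap.range f) := by
    apply Submodule.finrank_mono
    rintro _ ⟨v, rfl⟩
    refine ⟨⟨M.mulVecLin (Sum.elim 0 v), ⟨_, rfl⟩⟩, ?_⟩
    ext i
    simp [f, π, hM, LinearMap.funLeft_apply, Matrix.fromBlocks_mulVec]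
  have h3 : A.rank ≤ Module.finrank K (LinearMap.ker f) := by
    let j : (ι → K) →ₗ[K] (ι ⊕ ι' → K) :=
      { toFun := fun v => Sum.elim v 0
        map_add' := fun v w => by ext (i | i) <;> simp
        map_smul' := fun c v => by ext (i | i) <;> simp }
    have hj : ∀ w : LinearMap.range A.mulVecLin, j w ∈ V := by
      rintro ⟨_, ⟨v, rfl⟩⟩
      refine ⟨Sum.elim v 0, ?_⟩
      ext (i | i) <;> simp [j, hM, Matrix.fromBlocks_mulVec]
    let g : LinearMap.range A.mulVecLin →ₗ[K] V :=
      LinearMap.codRestrict V (j.comp (Submodule.subtype _)) hj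
    let g' : LinearMap.range A.mulVecLin →ₗ[K] LinearMap.ker f :=
      LinearMap.codRestrict _ g (fun w => by
        ext i
        exact (rfl : (0 : K) = 0))
    refine LinearMap.finrank_le_finrank_of_injective (f := g') ?_
    intro w w' hww
    have h4 : j w = j w' := congrArg (fun z : LinearMap.ker f => ((z : V) : ι ⊕ ι' → K)) hww
    ext i
    exact congrFun h4 (Sum.inl i)
  have : M.rank = Module.finrank K V := rfl
  omega

theorem rank_add_le_add_rank {K : Type*} [Field K] {ι κ : Type*} [Fintype ι] [Fintype κ]
    (M N : Matrix ι κ K) : (M + N).rank ≤ M.rank + N.rank := by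
  refine le_trans (Submodule.finrank_mono ?_) (Submodule.finrank_add_le_finrank_add_finrank _ _)
  rintro _ ⟨v, rfl⟩
  rw [Matrix.mulVecLin_add]
  exact Submodule.add_mem_sup ⟨v, rfl⟩ ⟨v, rfl⟩

theorem rank_fromBlocks_diag {K : Type*} [Field K] {ι κ ι' κ' : Type*} [Fintype ι]
    [Fintype κ] [Fintype ι'] [Fintype κ'] (A : Matrix ι κ K) (D : Matrix ι' κ' K) :
    (fromBlocks A 0 0 D).rank = A.rank + D.rank := by
  classical
  apply le_antisymm _ (rank_add_rank_le_rank_fromBlocks A 0 D)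
  have h1 : fromBlocks A 0 0 D =
      (fromRows 1 0 : Matrix (ι ⊕ ι') ι K) * (A * (fromCols 1 0 : Matrix κ (κ ⊕ κ') K)) +
      (fromRows 0 1 : Matrix (ι ⊕ ι') ι' K) * (D * (fromCols 0 1 : Matrix κ' (κ ⊕ κ') K)) := by
    simp only [mul_fromCols]
    ext (i | i) (j | j) <;> simp
  rw [h1]
  refine (rank_add_le_add_rank _ _).trans (add_le_add ?_ ?_)
  · exact (Matrix.rank_mul_le_right _ _).trans (Matrix.rank_mul_le_left _ _)
  · exact (Matrix.rank_mul_le_right _ _).trans (Matrix.rank_mul_le_left _ _)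

/-- A matrix of matrices as a single matrix. -/
def flatten {K ι κ n : Type*} (M : Matrix ι κ (Matrix n n K)) : Matrix (ι × n) (κ × n) K :=
  Matrix.of fun p q => M p.1 q.1 p.2 q.2

theorem flatten_apply {K ι κ n : Type*} (M : Matrix ι κ (Matrix n n K)) (i : ι) (a : n) (j : κ)
    (b : n) : flatten M (i, a) (j, b) = M i j a b := rfl

theorem flatten_zero {K ι κ n : Type*} [Zero K] :
    flatten (0 : Matrix ι κ (Matrix n n K)) = 0 := rfl

theorem flatten_mul {K ι κ l n : Type*} [Semiring K] [Fintype κ] [Fintype n]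
    (M : Matrix ι κ (Matrix n n K)) (M' : Matrix κ l (Matrix n n K)) :
    flatten (M * M') = flatten M * flatten M' := by
  ext ⟨i, a⟩ ⟨j, b⟩
  simp [flatten_apply, Matrix.mul_apply, Matrix.sum_apply, Fintype.sum_prod_type]

/-- The normalized rank of matrices over `Mₙ(K)`. -/
def matrixRank (K : Type*) [Field K] (N : ℕ) :
    MatrixFunction (Matrix (Fin (N + 1)) (Fin (N + 1)) K) :=
  fun _ _ M => ((flatten M).rank : ℝ) / (N + 1)

theorem rank_flatten_blockUpper {K : Type*} [Field K] {m n p q N : ℕ}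
    (A : Matrix (Fin m) (Fin n) (Matrix (Fin N) (Fin N) K))
    (B : Matrix (Fin m) (Fin q) (Matrix (Fin N) (Fin N) K))
    (D : Matrix (Fin p) (Fin q) (Matrix (Fin N) (Fin N) K)) :
    (flatten (blockUpper A B D)).rank =
      (fromBlocks (flatten A) (flatten B) 0 (flatten D)).rank := by
  rw [← Matrix.rank_submatrix (fromBlocks (flatten A) (flatten B) 0 (flatten D))
    (((finSumFinEquiv (m := m) (n := p)).prodCongr (Equiv.refl (Fin N))).symm.trans
      (Equiv.sumProdDistrib _ _ _))
    (((finSumFinEquiv (m := n) (n := q)).prodCongr (Equiv.refl (Fin N))).symm.trans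
      (Equiv.sumProdDistrib _ _ _))]
  congr 1
  ext ⟨i, a⟩ ⟨j, b⟩
  simp only [flatten_apply, blockUpper, Matrix.reindex_apply, Matrix.submatrix_apply,
    Equiv.trans_apply, Equiv.prodCongr_symm, Equiv.prodCongr_apply, Prod.map]
  rcases finSumFinEquiv.symm i with i | i <;> rcases finSumFinEquiv.symm j with j | j <;>
    simp [flatten_apply]

theorem isSylvesterRank_matrixRank (K : Type*) [Field K] (N : ℕ) :
    IsSylvesterRank (matrixRank K N) where
  nonneg _ _ _ := by unfold matrixRank; positivity
  zero m n := by
    simp [matrixRank, flatten_zero]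
  one := by
    have : flatten (1 : Matrix (Fin 1) (Fin 1) (Matrix (Fin (N + 1)) (Fin (N + 1)) K)) = 1 := by
      ext ⟨i, a⟩ ⟨j, b⟩
      have hij : i = j := Subsingleton.elim _ _
      simp [flatten_apply, hij, Matrix.one_apply]
    rw [matrixRank, this, Matrix.rank_one]
    have : (N : ℝ) + 1 ≠ 0 := by positivity
    simp [this]
  mul_le_left _ _ _ M₁ M₂ := by
    simp only [matrixRank, flatten_mul]
    have := Matrix.rank_mul_le_left (flatten M₁) (flatten M₂)
    gcongr
  mul_le_right _ _ _ M₁ M₂ := by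
    simp only [matrixRank, flatten_mul]
    have := Matrix.rank_mul_le_right (flatten M₁) (flatten M₂)
    gcongr
  diag _ _ _ _ A D := by
    simp only [matrixRank]
    rw [rank_flatten_blockUpper, ← add_div, flatten_zero, rank_fromBlocks_diag, Nat.cast_add]
  upper _ _ _ _ A B D := by
    simp only [matrixRank]
    rw [rank_flatten_blockUpper, ← add_div, ← Nat.cast_add]
    have := rank_add_rank_le_rank_fromBlocks (flatten A) (flatten B) (flatten D)
    gcongr

/-- Averages of rank functions are rank functions. -/
theorem isSylvesterRank_integral {R : Type*} [Ring R] {X : Type*} [MeasurableSpace X]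
    (μ : Measure X) [IsProbabilityMeasure μ] (σ : X → MatrixFunction R)
    (hσ : ∀ x, IsSylvesterRank (σ x))
    (hi : ∀ (m n : ℕ) (M : Matrix (Fin m) (Fin n) R), Integrable (fun x => σ x m n M) μ) :
    IsSylvesterRank (fun m n M => ∫ x, σ x m n M ∂μ) where
  nonneg _ _ _ := integral_nonneg fun x => (hσ x).nonneg _ _ _
  zero m n := by simp [(hσ _).zero]
  one := by simp [(hσ _).one]
  mul_le_left _ _ _ _ _ := integral_mono (hi _ _ _) (hi _ _ _) fun x => (hσ x).mul_le_left _ _ _ _ _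
  mul_le_right _ _ _ _ _ :=
    integral_mono (hi _ _ _) (hi _ _ _) fun x => (hσ x).mul_le_right _ _ _ _ _
  diag _ _ _ _ _ _ := by
    rw [← integral_add (hi _ _ _) (hi _ _ _)]
    simp only [(hσ _).diag]
  upper _ _ _ _ _ _ _ := by
    rw [← integral_add (hi _ _ _) (hi _ _ _)]
    exact integral_mono ((hi _ _ _).add (hi _ _ _)) (hi _ _ _) fun x => (hσ x).upper _ _ _ _ _ _ _

/-- The values stay in the compact interval `[0, m]`, where every ultrafilter converges. -/
theorem exists_tendsto_hyperfilter {R : Type*} [Ring R] {σ : ℕ → MatrixFunction R}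
    (hσ : ∀ N, IsSylvesterRank (σ N)) (m n : ℕ) (M : Matrix (Fin m) (Fin n) R) :
    ∃ l, Tendsto (fun N => σ N m n M) (hyperfilter ℕ) (𝓝 l) := by
  obtain ⟨l, -, hl⟩ := (isCompact_Icc (a := (0 : ℝ)) (b := m)).ultrafilter_le_nhds
    ((hyperfilter ℕ).map fun N : ℕ => σ N m n M) (by
      rw [Filter.le_principal_iff, Ultrafilter.coe_map, Filter.mem_map]
      exact Filter.univ_mem' fun N => ⟨(hσ N).nonneg _ _ _, (hσ N).le_card _ _ _⟩)
  exact ⟨l, hl⟩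

/-- The limit of a sequence of rank functions along a nonprincipal ultrafilter. -/
def ultralimit {R : Type*} [Ring R] (σ : ℕ → MatrixFunction R) : MatrixFunction R :=
  fun m n M => limUnder (hyperfilter ℕ : Filter ℕ) fun N => σ N m n M

theorem tendsto_ultralimit {R : Type*} [Ring R] {σ : ℕ → MatrixFunction R}
    (hσ : ∀ N, IsSylvesterRank (σ N)) (m n : ℕ) (M : Matrix (Fin m) (Fin n) R) :
    Tendsto (fun N => σ N m n M) (hyperfilter ℕ) (𝓝 (ultralimit σ m n M)) :=
  tendsto_nhds_limUnder (exists_tendsto_hyperfilter hσ m n M)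

theorem ultralimit_eq {R : Type*} [Ring R] {σ : ℕ → MatrixFunction R}
    (hσ : ∀ N, IsSylvesterRank (σ N)) {m n : ℕ} {M : Matrix (Fin m) (Fin n) R} {l : ℝ}
    (h : Tendsto (fun N => σ N m n M) atTop (𝓝 l)) : ultralimit σ m n M = l :=
  tendsto_nhds_unique (tendsto_ultralimit hσ m n M) (h.mono_left Nat.hyperfilter_le_atTop)

theorem isSylvesterRank_ultralimit {R : Type*} [Ring R] {σ : ℕ → MatrixFunction R}
    (hσ : ∀ N, IsSylvesterRank (σ N)) : IsSylvesterRank (ultralimit σ) where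
  nonneg m n M := ge_of_tendsto' (tendsto_ultralimit hσ m n M) fun N => (hσ N).nonneg _ _ _
  zero m n := ultralimit_eq hσ (by simp only [(hσ _).zero]; exact tendsto_const_nhds)
  one := ultralimit_eq hσ (by simp only [(hσ _).one]; exact tendsto_const_nhds)
  mul_le_left _ _ _ _ _ := le_of_tendsto_of_tendsto' (tendsto_ultralimit hσ _ _ _)
    (tendsto_ultralimit hσ _ _ _) fun N => (hσ N).mul_le_left _ _ _ _ _
  mul_le_right _ _ _ _ _ := le_of_tendsto_of_tendsto' (tendsto_ultralimit hσ _ _ _)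
    (tendsto_ultralimit hσ _ _ _) fun N => (hσ N).mul_le_right _ _ _ _ _
  diag m n p q A D := by
    refine tendsto_nhds_unique (tendsto_ultralimit hσ _ _ _) ?_
    simp only [(hσ _).diag]
    exact (tendsto_ultralimit hσ _ _ _).add (tendsto_ultralimit hσ _ _ _)
  upper _ _ _ _ _ _ _ := le_of_tendsto_of_tendsto'
    ((tendsto_ultralimit hσ _ _ _).add (tendsto_ultralimit hσ _ _ _))
    (tendsto_ultralimit hσ _ _ _) fun N => (hσ N).upper _ _ _ _ _ _ _

/-! ### The quotient by the elements of rank zero -/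

namespace IsSylvesterRank

variable {R : Type*} [Ring R] {τ : MatrixFunction R}

/-- The congruence `a ~ b ↔ rk(a - b) = 0`. -/
def nullCon (h : IsSylvesterRank τ) : RingCon R where
  r a b := eltRank τ (a - b) = 0
  iseqv :=
    { refl := fun a => by rw [sub_self]; exact h.eltRank_zero
      symm := fun {a b} hab => by rw [← neg_sub, h.eltRank_neg]; exact hab
      trans := fun {a b c} hab hbc => by
        have := h.eltRank_add_le (a - b) (b - c)
        rw [sub_add_sub_cancel] at this
        exact le_antisymm (by linarith) (h.eltRank_nonneg _) }
  add' := fun {a b c d} hab hcd => by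
    have := h.eltRank_add_le (a - b) (c - d)
    rw [← add_sub_add_comm] at this
    exact le_antisymm (by linarith) (h.eltRank_nonneg _)
  mul' := fun {a b c d} hab hcd => by
    have h1 : a * c - b * d = (a - b) * c + b * (c - d) := by noncomm_ring
    have h2 := h.eltRank_add_le ((a - b) * c) (b * (c - d))
    rw [← h1] at h2
    have h3 := h.eltRank_mul_le_left (a - b) c
    have h4 := h.eltRank_mul_le_right b (c - d)
    exact le_antisymm (by linarith) (h.eltRank_nonneg _)

theorem nullCon_iff (h : IsSylvesterRank τ) {a b : R} :
    h.nullCon a b ↔ eltRank τ (a - b) = 0 := Iff.rfl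

/-- The rank function induced on the quotient by the elements of rank zero. -/
def quot (h : IsSylvesterRank τ) : MatrixFunction h.nullCon.Quotient :=
  fun m n M => τ m n (M.map (Function.surjInv h.nullCon.mk'_surjective))

/-- Changing entries by elements of rank zero does not change ranks, so the representatives chosen
in `quot` are irrelevant. -/
theorem quot_map (h : IsSylvesterRank τ) {m n : ℕ} (M : Matrix (Fin m) (Fin n) R) :
    h.quot m n (M.map h.nullCon.mk') = τ m n M := by
  rw [quot, ← h.fval_fin, ← h.fval_fin]
  refine h.fval_congr_of_eltRank_sub fun i j => ?_
  rw [← h.nullCon_iff, ← RingCon.eq]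
  exact Function.surjInv_eq h.nullCon.mk'_surjective _

theorem exists_map_eq (h : IsSylvesterRank τ) {m n : ℕ}
    (M : Matrix (Fin m) (Fin n) h.nullCon.Quotient) :
    ∃ M' : Matrix (Fin m) (Fin n) R, M'.map h.nullCon.mk' = M :=
  ⟨M.map (Function.surjInv h.nullCon.mk'_surjective), by
    ext i j
    exact Function.surjInv_eq h.nullCon.mk'_surjective _⟩

theorem map_blockUpper {S : Type*} [Ring S] (φ : R →+* S) {m n p q : ℕ}
    (A : Matrix (Fin m) (Fin n) R) (B : Matrix (Fin m) (Fin q) R) (D : Matrix (Fin p) (Fin q) R) :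
    blockUpper (A.map φ) (B.map φ) (D.map φ) = (blockUpper A B D).map φ := by
  simp [blockUpper, ← Matrix.submatrix_map, Matrix.fromBlocks_map]

theorem isSylvesterRank_quot (h : IsSylvesterRank τ) : IsSylvesterRank h.quot where
  nonneg _ _ _ := h.nonneg _ _ _
  zero m n := by
    have := h.quot_map (0 : Matrix (Fin m) (Fin n) R)
    rwa [Matrix.map_zero _ (map_zero _), h.zero] at this
  one := by
    have := h.quot_map (1 : Matrix (Fin 1) (Fin 1) R)
    rwa [Matrix.map_one _ (map_zero _) (map_one _), h.one] at this
  mul_le_left m n p M N := by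
    obtain ⟨M, rfl⟩ := h.exists_map_eq M
    obtain ⟨N, rfl⟩ := h.exists_map_eq N
    rw [← Matrix.map_mul, h.quot_map, h.quot_map]
    exact h.mul_le_left _ _ _ _ _
  mul_le_right m n p M N := by
    obtain ⟨M, rfl⟩ := h.exists_map_eq M
    obtain ⟨N, rfl⟩ := h.exists_map_eq N
    rw [← Matrix.map_mul, h.quot_map, h.quot_map]
    exact h.mul_le_right _ _ _ _ _
  diag m n p q M N := by
    obtain ⟨M, rfl⟩ := h.exists_map_eq M
    obtain ⟨N, rfl⟩ := h.exists_map_eq N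
    have := map_blockUpper h.nullCon.mk' M 0 N
    rw [Matrix.map_zero _ (map_zero _)] at this
    rw [this, h.quot_map, h.quot_map, h.quot_map]
    exact h.diag _ _ _ _ _ _
  upper m n p q M B N := by
    obtain ⟨M, rfl⟩ := h.exists_map_eq M
    obtain ⟨N, rfl⟩ := h.exists_map_eq N
    obtain ⟨B, rfl⟩ := h.exists_map_eq B
    rw [map_blockUpper, h.quot_map, h.quot_map, h.quot_map]
    exact h.upper _ _ _ _ _ _ _

theorem isRankFunction_quot (h : IsSylvesterRank τ) : IsRankFunction (eltRank h.quot) where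
  mem_Icc x := ⟨h.isSylvesterRank_quot.eltRank_nonneg x, h.isSylvesterRank_quot.eltRank_le_one x⟩
  map_zero := h.isSylvesterRank_quot.eltRank_zero
  map_one := h.isSylvesterRank_quot.eltRank_one
  mul_le_left := h.isSylvesterRank_quot.eltRank_mul_le_left
  mul_le_right := h.isSylvesterRank_quot.eltRank_mul_le_right
  add_of_orthogonal _ _ := h.isSylvesterRank_quot.eltRank_add_of_orthogonal
  eq_zero x hx := by
    obtain ⟨a, rfl⟩ := h.nullCon.mk'_surjective x
    have : !![h.nullCon.mk' a] = (!![a] : Matrix (Fin 1) (Fin 1) R).map h.nullCon.mk' := by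
      ext i j; fin_cases i; fin_cases j; rfl
    rw [eltRank, this, h.quot_map] at hx
    rw [← map_zero h.nullCon.mk']
    exact (RingCon.eq _).2 (h.nullCon_iff.2 (by rwa [sub_zero]))

end IsSylvesterRank

/-- A map into a regular ring with a rank function which is a ring homomorphism up to elements of
rank zero induces a rank function in `ℙ_reg`. -/
theorem mem_regularSylvesterRanks.{u} {A R : Type u} [Ring A] [Ring R]
    (hR : IsVonNeumannRegular R) {τ : MatrixFunction R} (h : IsSylvesterRank τ) (φ : A → R)
    (hadd : ∀ a b, φ (a + b) = φ a + φ b) (hone : φ 1 = 1)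
    (hmul : ∀ a b, eltRank τ (φ (a * b) - φ a * φ b) = 0) :
    (fun m n (M : Matrix (Fin m) (Fin n) A) => τ m n (M.map φ)) ∈ regularSylvesterRanks A := by
  have hzero : φ 0 = 0 := by simpa using hadd 0 0
  -- The defect of multiplicativity of `φ` dies in the quotient, where moreover only zero has rank
  -- zero.
  let ψ : A →+* h.nullCon.Quotient :=
    { toFun := fun a => h.nullCon.mk' (φ a)
      map_one' := by rw [hone, map_one]
      map_mul' := fun a b => by
        rw [← map_mul]
        exact (RingCon.eq _).2 (hmul a b)
      map_zero' := by rw [hzero, map_zero]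
      map_add' := fun a b => by rw [hadd, map_add] }
  have key : ∀ (m n : ℕ) (M : Matrix (Fin m) (Fin n) A),
      τ m n (M.map φ) = h.quot m n (M.map ψ) := fun m n M => (h.quot_map (M.map φ)).symm
  refine ⟨?_, h.nullCon.Quotient, inferInstance, eltRank h.quot, h.quot, ψ, ?_,
    h.isRankFunction_quot, h.isSylvesterRank_quot, fun _ => rfl, key⟩
  · simp only [key]
    exact h.isSylvesterRank_quot.pullback ψ
  · intro x
    obtain ⟨a, rfl⟩ := h.nullCon.mk'_surjective x
    obtain ⟨b, hb⟩ := hR a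
    exact ⟨h.nullCon.mk' b, by rw [← map_mul, ← map_mul, ← hb]⟩

end

noncomputable section

/-! ### Computations in the crossed product -/

section CrossedProductAPI

variable {K : Type*} [Field K] {X : Type*} [TopologicalSpace X] (T : X ≃ₜ X)

/-- The function `g ∘ T⁻ᵏ`. -/
def shift (k : ℤ) (g : LocallyConstant X K) : LocallyConstant X K :=
  g.comap ⟨(T ^ (-k) : X ≃ₜ X), (T ^ (-k) : X ≃ₜ X).continuous⟩

omit [Field K] in
@[simp] theorem shift_apply (k : ℤ) (g : LocallyConstant X K) (x : X) :
    shift T k g x = g ((T ^ (-k) : X ≃ₜ X) x) := rfl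

theorem homeoAutomorphism_zpow_apply (k : ℤ) (g : LocallyConstant X K) :
    (homeoAutomorphism K T ^ k) g = shift T k g := by
  have h1 : ∀ g : LocallyConstant X K, homeoAutomorphism K T g = shift T 1 g := fun g => by
    ext x
    simp [homeoAutomorphism]
  induction k using Int.induction_on generalizing g with
  | zero => ext x; simp
  | succ n ih =>
    rw [zpow_add_one, RingAut.mul_apply, ih, h1]
    ext x
    simp only [shift_apply, ← Homeomorph.mul_apply, ← zpow_add]
    congr 3
    ring
  | pred n ih =>
    rw [zpow_sub_one, RingAut.mul_apply, ih]
    have h2 : (homeoAutomorphism K T)⁻¹ g = shift T (-1) g := by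
      rw [RingAut.inv_apply, RingEquiv.symm_apply_eq, h1]
      ext x
      simp only [shift_apply, ← Homeomorph.mul_apply, ← zpow_add]
      simp
    rw [h2]
    ext x
    simp only [shift_apply, ← Homeomorph.mul_apply, ← zpow_add]
    congr 3
    ring

/-- The element `f tᵏ` of the crossed product. -/
def mono (f : LocallyConstant X K) (k : ℤ) : DynCrossedProduct K T :=
  (SkewMonoidAlgebra.single (Multiplicative.ofAdd k) f :
    SkewMonoidAlgebra (LocallyConstant X K) (Multiplicative ℤ))

theorem incl_eq_mono (f : LocallyConstant X K) :
    CrossedProduct.incl (homeoAutomorphism K T) f = mono T f 0 := rfl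

theorem mono_add (f g : LocallyConstant X K) (k : ℤ) :
    mono T (f + g) k = mono T f k + mono T g k :=
  SkewMonoidAlgebra.single_add _ _ _

theorem mono_zero (k : ℤ) : mono T (0 : LocallyConstant X K) k = 0 :=
  SkewMonoidAlgebra.single_zero _

theorem mono_sub (f g : LocallyConstant X K) (k : ℤ) :
    mono T (f - g) k = mono T f k - mono T g k := by
  rw [eq_sub_iff_add_eq, ← mono_add, sub_add_cancel]

theorem mono_one_zero : mono T (1 : LocallyConstant X K) 0 = 1 := rfl

theorem mono_mul_mono (f g : LocallyConstant X K) (k l : ℤ) :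
    mono T f k * mono T g l = mono T (f * shift T k g) (k + l) := by
  let := automorphismAction (homeoAutomorphism K T)
  rw [← homeoAutomorphism_zpow_apply]
  exact SkewMonoidAlgebra.single_mul_single

theorem mono_one_mul_mono_one (k l : ℤ) :
    mono T (1 : LocallyConstant X K) k * mono T 1 l = mono T 1 (k + l) := by
  rw [mono_mul_mono]
  congr 1
  ext x
  simp

@[elab_as_elim]
theorem crossed_induction {p : DynCrossedProduct K T → Prop} (a : DynCrossedProduct K T)
    (zero : p 0) (mono : ∀ f k, p (mono T f k)) (add : ∀ a b, p a → p b → p (a + b)) : p a :=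
  SkewMonoidAlgebra.induction_on (p := p) a zero (fun k f => mono f k) add

/-- The coefficient of `tᵏ`. -/
def coef (a : DynCrossedProduct K T) (k : ℤ) : LocallyConstant X K :=
  SkewMonoidAlgebra.coeff (a : SkewMonoidAlgebra (LocallyConstant X K) (Multiplicative ℤ))
    (Multiplicative.ofAdd k)

theorem coef_add (a b : DynCrossedProduct K T) (k : ℤ) :
    coef T (a + b) k = coef T a k + coef T b k := by
  have := SkewMonoidAlgebra.coeff_add
    (a : SkewMonoidAlgebra (LocallyConstant X K) (Multiplicative ℤ)) b
  exact DFunLike.congr_fun this (Multiplicative.ofAdd k)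

theorem coef_mono (f : LocallyConstant X K) (k l : ℤ) :
    coef T (mono T f k) l = if k = l then f else 0 := by
  classical
  exact SkewMonoidAlgebra.coeff_single_apply

theorem coef_one (l : ℤ) :
    coef T (1 : DynCrossedProduct K T) l = if 0 = l then 1 else 0 :=
  coef_mono T 1 0 l

end CrossedProductAPI

end

noncomputable section

/-! ### The rank function obtained by compressing to orbit segments -/

section Compression

open Matrix Filter Topology

variable {K : Type*} [Field K] {X : Type*} [TopologicalSpace X]

/-- Gaussian elimination by transvections, which are invertible. It serves regularity as well as
both uniqueness results for commutative rings. -/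
theorem exists_isUnit_mul_diagonal_mul {n : Type*} [Fintype n] [DecidableEq n] (M : Matrix n n K) :
    ∃ (L L' D : Matrix n n K), ∃ d : n → K, D = diagonal d ∧ IsUnit L ∧ IsUnit L' ∧
      M = L * D * L' := by
  obtain ⟨L, L', d, h⟩ := Matrix.Pivot.exists_list_transvec_mul_diagonal_mul_list_transvec M
  have hu : ∀ L : List (TransvectionStruct n K),
      IsUnit (L.map TransvectionStruct.toMatrix).prod := fun L =>
    ⟨⟨_, (L.reverse.map (TransvectionStruct.toMatrix ∘ TransvectionStruct.inv)).prod,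
      TransvectionStruct.prod_mul_reverse_inv_prod L,
      TransvectionStruct.reverse_inv_prod_mul_prod L⟩, rfl⟩
  exact ⟨_, _, _, d, rfl, hu L, hu L', h⟩

theorem isVonNeumannRegular_matrix (K : Type*) [Field K] (n : Type*) [Fintype n] [DecidableEq n] :
    IsVonNeumannRegular (Matrix n n K) := by
  intro M
  obtain ⟨_, _, _, d, rfl, ⟨U, rfl⟩, ⟨V, rfl⟩, rfl⟩ := exists_isUnit_mul_diagonal_mul M
  refine ⟨((V⁻¹ : (Matrix n n K)ˣ) : Matrix n n K) * diagonal (fun i => (d i)⁻¹) *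
    ((U⁻¹ : (Matrix n n K)ˣ) : Matrix n n K), ?_⟩
  have h : diagonal d = diagonal d * diagonal (fun i => (d i)⁻¹) * diagonal d := by
    simp [Matrix.diagonal_mul_diagonal]
  conv_lhs => rw [h]
  simp only [Matrix.mul_assoc, Units.mul_inv_cancel_left, Units.inv_mul_cancel_left]

/-- The product of the algebras of locally constant functions with values in `Mₙ(K)`. -/
abbrev CompressionRing (K : Type*) [Field K] (X : Type*) [TopologicalSpace X] : Type _ :=
  ∀ N : ℕ, LocallyConstant X (Matrix (Fin (N + 1)) (Fin (N + 1)) K)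

/-- A quasi-inverse chosen once for every scalar matrix and applied pointwise keeps functions
locally constant. -/
theorem isVonNeumannRegular_compressionRing : IsVonNeumannRegular (CompressionRing K X) := by
  intro r
  have h : ∀ N : ℕ, ∀ M : Matrix (Fin (N + 1)) (Fin (N + 1)) K, ∃ M', M = M * M' * M := fun N =>
    isVonNeumannRegular_matrix K _
  choose g hg using h
  refine ⟨fun N => (r N).map (g N), ?_⟩
  funext N
  ext1 x
  exact hg N (r N x)

/-- Evaluation of the `N`-th component at `x`. -/
def evalHom (K : Type*) [Field K] (N : ℕ) (x : X) :
    CompressionRing K X →+* Matrix (Fin (N + 1)) (Fin (N + 1)) K :=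
  (LocallyConstant.evalRingHom x).comp (Pi.evalRingHom _ N)

variable [CompactSpace X] [MeasurableSpace X] [BorelSpace X]

/-- The average over `X` of the normalized ranks of the `N`-th components. -/
def levelRank (K : Type*) [Field K] (μ : Measure X) (N : ℕ) : MatrixFunction (CompressionRing K X) :=
  fun m n M => ∫ x, matrixRank K N m n (M.map (evalHom K N x)) ∂μ

theorem LocallyConstant.integrable (f : LocallyConstant X ℝ) (μ : Measure X) [IsFiniteMeasure μ] :
    Integrable f μ :=
  f.continuous.integrable_of_hasCompactSupport (HasCompactSupport.of_compactSpace f)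

theorem isSylvesterRank_levelRank (μ : Measure X) [IsProbabilityMeasure μ] (N : ℕ) :
    IsSylvesterRank (levelRank K μ N) := by
  refine isSylvesterRank_integral μ _
    (fun x => (isSylvesterRank_matrixRank K N).pullback (evalHom K N x)) fun m n M => ?_
  -- The integrand is a function of the locally constant matrix of all `N`-th components, hence
  -- itself locally constant.
  exact LocallyConstant.integrable ((LocallyConstant.unflip fun i =>
    LocallyConstant.unflip fun j => M i j N).map fun A => matrixRank K N m n A) μ

/-- The rank function on the product of matrix algebras. -/
def compressionRank (K : Type*) [Field K] (μ : Measure X) : MatrixFunction (CompressionRing K X) :=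
  ultralimit (levelRank K μ)

theorem isSylvesterRank_compressionRank (μ : Measure X) [IsProbabilityMeasure μ] :
    IsSylvesterRank (compressionRank K μ) :=
  isSylvesterRank_ultralimit (isSylvesterRank_levelRank μ)

omit [CompactSpace X] [BorelSpace X] in
theorem eltRank_levelRank (μ : Measure X) (N : ℕ) (r : CompressionRing K X) :
    eltRank (levelRank K μ N) r = ∫ x, ((r N x).rank : ℝ) / (N + 1) ∂μ := by
  simp only [eltRank, levelRank, matrixRank]
  congr 1
  funext x
  congr 2
  rw [← Matrix.rank_submatrix _ (Equiv.uniqueProd _ (Fin 1)).symm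
    (Equiv.uniqueProd _ (Fin 1)).symm]
  rfl

omit [CompactSpace X] [MeasurableSpace X] [BorelSpace X] in
/-- The compression of `a` to the orbit segments `x, Tx, …, Tᴺx`. -/
def compress (T : X ≃ₜ X) (a : DynCrossedProduct K T) : CompressionRing K X := fun N =>
  LocallyConstant.unflip fun i : Fin (N + 1) => LocallyConstant.unflip fun j : Fin (N + 1) =>
    shift T (-(i : ℤ)) (coef T a (i - j))

variable (T : X ≃ₜ X)

omit [CompactSpace X] [MeasurableSpace X] [BorelSpace X] in
-- On functions along the orbit, `f tᵏ` moves position `j` to `i = j + k` and multiplies by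
-- `f(Tⁱx)`; this explains the index `i - j` and the evaluation point.
theorem compress_apply (a : DynCrossedProduct K T) (N : ℕ) (x : X) (i j : Fin (N + 1)) :
    compress T a N x i j = coef T a (i - j) ((T ^ (i : ℤ) : X ≃ₜ X) x) := by
  have : (T ^ (i : ℤ) : X ≃ₜ X) x = (T ^ (-(-(i : ℤ))) : X ≃ₜ X) x := by rw [neg_neg]
  rw [this]
  rfl

omit [CompactSpace X] [MeasurableSpace X] [BorelSpace X] in
theorem compress_add (a b : DynCrossedProduct K T) :
    compress T (a + b) = compress T a + compress T b := by
  funext N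
  ext x i j
  change compress T (a + b) N x i j = compress T a N x i j + compress T b N x i j
  simp [compress_apply, coef_add]

omit [CompactSpace X] [MeasurableSpace X] [BorelSpace X] in
theorem compress_one : compress T (1 : DynCrossedProduct K T) = 1 := by
  funext N
  ext x i j
  change compress T 1 N x i j = (1 : Matrix (Fin (N + 1)) (Fin (N + 1)) K) i j
  rw [compress_apply, coef_one, Matrix.one_apply]
  by_cases h : i = j
  · simp [h]
  · have : ¬ (0 : ℤ) = (i : ℤ) - j := fun h' => h (Fin.ext (by omega))
    simp [h, this]

omit [CompactSpace X] [MeasurableSpace X] [BorelSpace X] in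
-- The two products differ only in rows `i` whose intermediate position `i - k` falls outside the
-- segment `0, …, N`; there are at most `|k|` such rows.
theorem rank_compress_mul_sub_le (f g : LocallyConstant X K) (k l : ℤ) (N : ℕ) (x : X) :
    ((compress T (mono T f k * mono T g l) - compress T (mono T f k) * compress T (mono T g l))
      N x).rank ≤ k.natAbs := by
  classical
  -- `D` marks the rows for which the intermediate position leaves the segment.
  set D : Fin (N + 1) → K := fun i => if 0 ≤ (i : ℤ) - k ∧ (i : ℤ) - k ≤ N then 0 else 1 with hD
  have h1 : (compress T (mono T f k * mono T g l) -
      compress T (mono T f k) * compress T (mono T g l)) N x =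
      diagonal D * compress T (mono T f k * mono T g l) N x := by
    ext i j
    change compress T (mono T f k * mono T g l) N x i j -
      (compress T (mono T f k) N x * compress T (mono T g l) N x) i j = _
    rw [Matrix.mul_apply, Matrix.diagonal_mul, mono_mul_mono]
    simp only [compress_apply, coef_mono]
    by_cases hi : 0 ≤ (i : ℤ) - k ∧ (i : ℤ) - k ≤ N
    · have hm : ((i : ℤ) - k).toNat < N + 1 := by omega
      rw [Finset.sum_eq_single (⟨((i : ℤ) - k).toNat, hm⟩ : Fin (N + 1))]
      · have e1 : k = (i : ℤ) - (((i : ℤ) - k).toNat : ℤ) := by omega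
        have e2 : ((((i : ℤ) - k).toNat : ℕ) : ℤ) = -k + i := by omega
        simp only [hD, hi, and_self, if_true, zero_mul, ← e1]
        by_cases hj : k + l = (i : ℤ) - j
        · have hj' : l = (((i : ℤ) - k).toNat : ℤ) - j := by omega
          simp only [← hj', if_pos hj, if_true]
          rw [e2, _root_.zpow_add]
          simp
        · have hj' : ¬ l = (((i : ℤ) - k).toNat : ℤ) - j := by omega
          rw [if_neg hj, if_neg hj']
          simp
      · intro m _ hm'
        have : ¬ k = (i : ℤ) - m := fun h => hm' (Fin.ext (by simp; omega))
        simp [this]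
      · simp
    · rw [Finset.sum_eq_zero]
      · simp only [hD, if_neg hi, sub_zero, one_mul]
      · intro m _
        have : ¬ k = (i : ℤ) - m := by omega
        simp [this]
  rw [h1]
  refine (Matrix.rank_mul_le_left _ _).trans ?_
  rw [Matrix.rank_diagonal, Fintype.card_subtype]
  have h2 : ∀ i : Fin (N + 1), D i ≠ 0 ↔ ((i : ℤ) < k ∨ N + k < i) := fun i => by
    simp only [hD]
    split_ifs with h
    · simp; omega
    · simp; omega
  simp only [h2]
  calc _ ≤ (Finset.image (fun i : Fin (N + 1) => (i : ℕ)) (Finset.univ.filter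
        fun i : Fin (N + 1) => ((i : ℤ) < k ∨ N + k < i))).card := by
        rw [Finset.card_image_of_injective _ Fin.val_injective]
    -- The marked rows are among the first `|k|` for `k ≥ 0` and among the last `|k|` for `k < 0`.
    _ ≤ (if 0 ≤ k then Finset.range k.natAbs else Finset.Ico (N + 1 - k.natAbs) (N + 1)).card := by
        apply Finset.card_le_card
        intro i hi
        simp only [Finset.mem_image, Finset.mem_filter, Finset.mem_univ, true_and] at hi
        obtain ⟨i, hi, rfl⟩ := hi
        split_ifs with hk
        · simp; omega
        · simp; omega
    _ ≤ k.natAbs := by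
        split_ifs
        · simp
        · simp; omega

/-- The defect is biadditive, which reduces the claim to monomials; there its normalized rank is at
most `|k|/(N+1)`. -/
theorem eltRank_compress_mul_sub (μ : Measure X) [IsProbabilityMeasure μ]
    (a b : DynCrossedProduct K T) :
    eltRank (compressionRank K μ) (compress T (a * b) - compress T a * compress T b) = 0 := by
  have hτ := isSylvesterRank_compressionRank (K := K) μ
  have hzero : compress T (0 : DynCrossedProduct K T) = 0 := by
    simpa using compress_add T (0 : DynCrossedProduct K T) 0
  have hsum : ∀ u v : CompressionRing K X, eltRank (compressionRank K μ) u = 0 →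
      eltRank (compressionRank K μ) v = 0 → eltRank (compressionRank K μ) (u + v) = 0 :=
    fun u v hu hv => le_antisymm ((hτ.eltRank_add_le u v).trans (by rw [hu, hv, add_zero]))
      (hτ.eltRank_nonneg _)
  induction a using crossed_induction with
  | zero => simp [hzero, hτ.eltRank_zero]
  | add a a' ha ha' =>
    have := hsum _ _ ha ha'
    rw [add_mul, compress_add, compress_add, add_mul, add_sub_add_comm]
    exact this
  | mono f k =>
    induction b using crossed_induction with
    | zero => simp [hzero, hτ.eltRank_zero]
    | add b b' hb hb' =>
      have := hsum _ _ hb hb'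
      rw [mul_add, compress_add, compress_add, mul_add, add_sub_add_comm]
      exact this
    | mono g l =>
      refine ultralimit_eq (isSylvesterRank_levelRank μ) ?_
      have h0 : Tendsto (fun N : ℕ => (k.natAbs : ℝ) / ((N : ℝ) + 1)) atTop (𝓝 0) := by
        have := (tendsto_const_div_atTop_nhds_zero_nat (k.natAbs : ℝ)).comp
          (tendsto_add_atTop_nat 1)
        simpa only [Function.comp_def, Nat.cast_add, Nat.cast_one] using this
      refine squeeze_zero (fun N => (isSylvesterRank_levelRank μ N).nonneg _ _ _) (fun N => ?_) h0
      change eltRank (levelRank K μ N) _ ≤ _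
      rw [eltRank_levelRank]
      calc _ ≤ ∫ _ : X, (k.natAbs : ℝ) / ((N : ℝ) + 1) ∂μ := by
            refine integral_mono_of_nonneg (Filter.Eventually.of_forall fun x => by positivity)
              (integrable_const _) (Filter.Eventually.of_forall fun x => ?_)
            have := rank_compress_mul_sub_le T f g k l N x
            exact div_le_div_of_nonneg_right (Nat.cast_le.2 this) (by positivity)
        _ = _ := by simp

/-- The rank function of an invariant measure. -/
def measureRank (μ : Measure X) : MatrixFunction (DynCrossedProduct K T) :=
  fun m n M => compressionRank K μ m n (M.map (compress T))

theorem measureRank_mem_regularSylvesterRanks (μ : Measure X) [IsProbabilityMeasure μ] :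
    measureRank T μ ∈ regularSylvesterRanks (DynCrossedProduct K T) :=
  mem_regularSylvesterRanks isVonNeumannRegular_compressionRing
    (isSylvesterRank_compressionRank μ) (compress T) (compress_add T) (compress_one T)
    (eltRank_compress_mul_sub T μ)

omit [CompactSpace X] [BorelSpace X] in
theorem eltRank_measureRank (μ : Measure X) (a : DynCrossedProduct K T) :
    eltRank (measureRank T μ) a = eltRank (compressionRank K μ) (compress T a) := by
  simp only [eltRank, measureRank]
  congr 1
  ext i j
  fin_cases i; fin_cases j; rfl

omit [CompactSpace X] in
theorem measurePreserving_zpow {μ : Measure X} (h : MeasurePreserving T μ μ) (k : ℤ) :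
    MeasurePreserving (T ^ k : X ≃ₜ X) μ μ := by
  have hs : MeasurePreserving T.symm μ μ := h.symm T.toMeasurableEquiv
  induction k using Int.induction_on with
  | zero => exact MeasurePreserving.id μ
  | succ n ih => rw [_root_.zpow_add_one]; exact ih.comp h
  | pred n ih => rw [_root_.zpow_sub_one]; exact ih.comp hs

/-- The compression of `χ_U` is diagonal and its rank counts visits to `U`. By invariance each of
the `N + 1` positions contributes `μ(U)`, so no limit is really taken. -/
theorem measureRank_chi {μ : Measure X} [IsProbabilityMeasure μ] (h : MeasurePreserving T μ μ)
    {U : Set X} (hU : IsClopen U) : eltRank (measureRank T μ) (chi K T hU) = μ.real U := by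
  classical
  rw [eltRank_measureRank]
  refine ultralimit_eq (isSylvesterRank_levelRank μ) ?_
  have : ∀ N, levelRank K μ N 1 1 !![compress T (chi K T hU)] = μ.real U := by
    intro N
    change eltRank (levelRank K μ N) _ = _
    rw [eltRank_levelRank]
    have h1 : ∀ x, ((compress T (chi K T hU) N x).rank : ℝ) =
        ∑ i : Fin (N + 1), ((T ^ (i : ℤ) : X ≃ₜ X) ⁻¹' U).indicator (fun _ => (1 : ℝ)) x := by
      intro x
      have h2 : compress T (chi K T hU) N x =
          diagonal fun i : Fin (N + 1) => if (T ^ (i : ℤ) : X ≃ₜ X) x ∈ U then (1 : K) else 0 := by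
        ext i j
        rw [compress_apply, chi, incl_eq_mono, coef_mono, diagonal_apply]
        by_cases hij : i = j
        · simp [hij, LocallyConstant.coe_charFn, Set.indicator]
        · have : ¬ (0 : ℤ) = (i : ℤ) - j := fun h' => hij (Fin.ext (by omega))
          simp [hij, this]
      rw [h2, Matrix.rank_diagonal, Fintype.card_subtype]
      simp [Set.indicator_apply]
    simp only [h1]
    rw [integral_div, integral_finsetSum]
    · have h3 : ∀ i : Fin (N + 1),
          ∫ x, ((T ^ (i : ℤ) : X ≃ₜ X) ⁻¹' U).indicator (fun _ => (1 : ℝ)) x ∂μ = μ.real U := by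
        intro i
        have hm := measurePreserving_zpow T h (i : ℤ)
        rw [integral_indicator_const _ (hm.measurable hU.isOpen.measurableSet), smul_eq_mul, mul_one,
          hm.measureReal_preimage hU.isOpen.measurableSet.nullMeasurableSet]
      simp only [h3]
      have : (N : ℝ) + 1 ≠ 0 := by positivity
      simp
      field_simp
    · intro i _
      exact (integrable_const _).indicator
        ((T ^ (i : ℤ) : X ≃ₜ X).continuous.measurable hU.isOpen.measurableSet)
  simp only [this]
  exact tendsto_const_nhds

end Compression

end

noncomputable section

/-! ### Invariant measures from rank functions -/

section InvariantMeasure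

open Filter Topology

variable {K : Type*} [Field K] {X : Type*} [TopologicalSpace X] (T : X ≃ₜ X)

theorem charFn_mul_charFn {U V W : Set X} (hU : IsClopen U) (hV : IsClopen V) (hW : IsClopen W)
    (h : W = U ∩ V) :
    LocallyConstant.charFn K hU * LocallyConstant.charFn K hV = LocallyConstant.charFn K hW := by
  classical
  ext x
  by_cases hxU : x ∈ U <;> by_cases hxV : x ∈ V <;>
    simp [LocallyConstant.coe_charFn, h, hxU, hxV]

theorem chi_mul_chi {U V W : Set X} (hU : IsClopen U) (hV : IsClopen V) (hW : IsClopen W)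
    (h : W = U ∩ V) : chi K T hU * chi K T hV = chi K T hW := by
  rw [chi, chi, chi, ← map_mul, charFn_mul_charFn hU hV hW h]

theorem chi_eq_zero {U : Set X} (hU : IsClopen U) (h : U = ∅) : chi K T hU = 0 := by
  have : LocallyConstant.charFn K hU = 0 := by
    ext x
    simp [LocallyConstant.coe_charFn, h]
  rw [chi, this, map_zero]

theorem chi_eq_one {U : Set X} (hU : IsClopen U) (h : U = Set.univ) : chi K T hU = 1 := by
  have : LocallyConstant.charFn K hU = 1 := by
    ext x
    simp [LocallyConstant.coe_charFn, h]
  rw [chi, this, map_one]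

theorem chi_add_chi {U V : Set X} (hU : IsClopen U) (hV : IsClopen V) (h : Disjoint U V) :
    chi K T hU + chi K T hV = chi K T (hU.union hV) := by
  classical
  rw [chi, chi, chi, ← map_add]
  congr 1
  ext x
  by_cases hxU : x ∈ U
  · simp [LocallyConstant.coe_charFn, hxU, Set.disjoint_left.1 h hxU]
  · simp [LocallyConstant.coe_charFn, hxU, Set.indicator_apply]

theorem chi_preimage {U : Set X} (hU : IsClopen U) :
    chi K T (hU.preimage T.continuous) = mono T 1 (-1) * chi K T hU * mono T 1 1 := by
  rw [chi, chi, incl_eq_mono, incl_eq_mono, mono_mul_mono, mono_mul_mono]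
  congr 1
  ext x
  simp only [LocallyConstant.coe_charFn, LocallyConstant.coe_mul, LocallyConstant.coe_one, Pi.mul_apply,
    shift_apply]
  simp
  rfl

namespace IsSylvesterRank

variable {T} {rk : MatrixFunction (DynCrossedProduct K T)}

theorem eltRank_chi_union (h : IsSylvesterRank rk) {U V : Set X} (hU : IsClopen U)
    (hV : IsClopen V) (hd : Disjoint U V) : eltRank rk (chi K T (hU.union hV)) =
      eltRank rk (chi K T hU) + eltRank rk (chi K T hV) := by
  rw [← chi_add_chi T hU hV hd]
  have h0 : chi K T hU * chi K T hV = 0 := by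
    rw [chi_mul_chi T hU hV (hU.inter hV) rfl, chi_eq_zero T _ hd.inter_eq]
  have h0' : chi K T hV * chi K T hU = 0 := by
    rw [chi_mul_chi T hV hU (hV.inter hU) rfl, chi_eq_zero T _ hd.symm.inter_eq]
  exact h.eltRank_add_of_orthogonal (chi_mul_chi T hU hU hU (by simp))
    (chi_mul_chi T hV hV hV (by simp)) h0 h0'

/-- Conjugation by the unit `t` preserves rank; this is the source of invariance of the induced
measure. -/
theorem eltRank_chi_preimage (h : IsSylvesterRank rk) {U : Set X} (hU : IsClopen U) :
    eltRank rk (chi K T (hU.preimage T.continuous)) = eltRank rk (chi K T hU) := by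
  have h1 : mono T 1 1 * mono T 1 (-1) = (1 : DynCrossedProduct K T) := by
    rw [mono_one_mul_mono_one, add_neg_cancel, mono_one_zero]
  apply le_antisymm
  · rw [chi_preimage T hU]
    exact (h.eltRank_mul_le_left _ _).trans (h.eltRank_mul_le_right _ _)
  · have h2 : chi K T hU =
        mono T 1 1 * chi K T (hU.preimage T.continuous) * mono T 1 (-1) := by
      rw [chi_preimage]
      have : ∀ a b c : DynCrossedProduct K T, a * b = 1 → a * (b * c * a) * b = c := by
        intro a b c hab
        rw [← mul_assoc, ← mul_assoc, hab, one_mul, mul_assoc, hab, mul_one]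
      rw [this _ _ _ h1]
    conv_lhs => rw [h2]
    exact (h.eltRank_mul_le_left _ _).trans (h.eltRank_mul_le_right _ _)

open Classical in
/-- The additive content on clopen sets defined by a rank function. -/
def content (h : IsSylvesterRank rk) : AddContent ℝ≥0∞ {U : Set X | IsClopen U} :=
  IsSetRing.addContent_of_union
    (fun U => if hU : IsClopen U then ENNReal.ofReal (eltRank rk (chi K T hU)) else 0)
    ⟨isClopen_empty, fun _ _ hU hV => hU.union hV, fun _ _ hU hV => hU.diff hV⟩
    (by rw [dif_pos isClopen_empty, chi_eq_zero T _ rfl, h.eltRank_zero, ENNReal.ofReal_zero])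
    (fun {U V} hU hV hd => by
      have hU' : IsClopen U := hU
      have hV' : IsClopen V := hV
      rw [dif_pos (hU'.union hV'), dif_pos hU', dif_pos hV', h.eltRank_chi_union hU' hV' hd,
        ENNReal.ofReal_add (h.eltRank_nonneg _) (h.eltRank_nonneg _)])

theorem content_apply (h : IsSylvesterRank rk) {U : Set X} (hU : IsClopen U) :
    h.content U = ENNReal.ofReal (eltRank rk (chi K T hU)) :=
  dif_pos hU

variable [CompactSpace X] [T2Space X] [TotallyDisconnectedSpace X] [SecondCountableTopology X]
  [MeasurableSpace X] [BorelSpace X]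

omit [CompactSpace X] [T2Space X] [TotallyDisconnectedSpace X] [SecondCountableTopology X]
  [MeasurableSpace X] [BorelSpace X] in
theorem isSetRing_isClopen : IsSetRing {U : Set X | IsClopen U} :=
  ⟨isClopen_empty, fun _ _ hU hV => hU.union hV, fun _ _ hU hV => hU.diff hV⟩

theorem _root_.measurableSpace_eq_generateFrom_isClopen :
    ‹MeasurableSpace X› = MeasurableSpace.generateFrom {U : Set X | IsClopen U} := by
  rw [BorelSpace.measurable_eq (α := X)]
  exact isTopologicalBasis_isClopen.borel_eq_generateFrom

theorem _root_.measure_ext_isClopen {μ ν : Measure X} [IsFiniteMeasure μ]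
    (h : ∀ U : Set X, IsClopen U → μ U = ν U) : μ = ν :=
  ext_of_generate_finite _ measurableSpace_eq_generateFrom_isClopen
    isSetRing_isClopen.isSetSemiring.isPiSystem (fun U hU => h U hU) (h _ isClopen_univ)

omit [T2Space X] [TotallyDisconnectedSpace X] [SecondCountableTopology X]
  [MeasurableSpace X] [BorelSpace X] in
-- A clopen set is compact, so a countable clopen cover has a finite subcover and finite
-- subadditivity is enough.
theorem content_isSigmaSubadditive (h : IsSylvesterRank rk) :
    h.content.IsSigmaSubadditive := by
  intro f hf hU
  obtain ⟨t, ht⟩ := (IsClopen.isClosed hU).isCompact.elim_finite_subcover f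
    (fun i => (hf i).isOpen) subset_rfl
  have : ⋃ i, f i = ⋃ i ∈ t, f i :=
    subset_antisymm ht (Set.iUnion₂_subset fun i _ => Set.subset_iUnion f i)
  rw [this]
  exact (addContent_biUnion_le isSetRing_isClopen fun i _ => hf i).trans
    (ENNReal.sum_le_tsum t)

/-- Every rank function on the crossed product induces an invariant probability measure. -/
theorem exists_measure (h : IsSylvesterRank rk) : ∃ ν ∈ invariantProbabilityMeasures T,
    ∀ (U : Set X) (hU : IsClopen U), ν U = ENNReal.ofReal (eltRank rk (chi K T hU)) := by
  let ν := h.content.measure isSetRing_isClopen.isSetSemiring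
    measurableSpace_eq_generateFrom_isClopen.le h.content_isSigmaSubadditive
  have hν : ∀ (U : Set X) (hU : IsClopen U), ν U = ENNReal.ofReal (eltRank rk (chi K T hU)) := by
    intro U hU
    rw [← h.content_apply hU]
    exact h.content.measure_eq isSetRing_isClopen.isSetSemiring
      measurableSpace_eq_generateFrom_isClopen h.content_isSigmaSubadditive hU
  have hprob : IsProbabilityMeasure ν := ⟨by
    rw [hν _ isClopen_univ, chi_eq_one T _ rfl, h.eltRank_one, ENNReal.ofReal_one]⟩
  refine ⟨ν, ⟨⟨T.continuous.measurable, ?_⟩, hprob⟩, hν⟩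
  have := Measure.isFiniteMeasure_map ν T
  refine measure_ext_isClopen fun U hU => ?_
  rw [Measure.map_apply T.continuous.measurable hU.isOpen.measurableSet,
    hν _ (hU.preimage T.continuous), hν _ hU, h.eltRank_chi_preimage]

/-- If a convex combination of two rank functions induces an extreme invariant measure, then so
does each of them, and the induced measure is the same. -/
theorem eltRank_chi_eq_of_extremePoint {rk' : MatrixFunction (DynCrossedProduct K T)}
    (h : IsSylvesterRank rk) (h' : IsSylvesterRank rk') {μ : Measure X}
    (hμ : μ ∈ Set.extremePoints ℝ≥0∞ (invariantProbabilityMeasures T)) {s s' : ℝ} (hs : 0 < s)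
    (hs' : 0 < s') (hss : s + s' = 1)
    (H : ∀ (U : Set X) (hU : IsClopen U),
      s * eltRank rk (chi K T hU) + s' * eltRank rk' (chi K T hU) = μ.real U)
    {U : Set X} (hU : IsClopen U) : eltRank rk (chi K T hU) = μ.real U := by
  obtain ⟨ν, hν, hνU⟩ := h.exists_measure
  obtain ⟨ν', hν', hνU'⟩ := h'.exists_measure
  have := hμ.1.2
  -- The same combination of the induced measures agrees with `μ` on clopen sets, a π-system
  -- generating the Borel sets.
  have hμν : μ ∈ openSegment ℝ≥0∞ ν ν' := by
    refine ⟨ENNReal.ofReal s, ENNReal.ofReal s', by simpa, by simpa, ?_, ?_⟩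
    · rw [← ENNReal.ofReal_add hs.le hs'.le, hss, ENNReal.ofReal_one]
    · symm
      refine measure_ext_isClopen fun U hU => ?_
      rw [Measure.add_apply, Measure.smul_apply, Measure.smul_apply, hνU U hU, hνU' U hU,
        smul_eq_mul, smul_eq_mul, ← ENNReal.ofReal_mul hs.le, ← ENNReal.ofReal_mul hs'.le,
        ← ENNReal.ofReal_add (mul_nonneg hs.le (h.eltRank_nonneg _))
          (mul_nonneg hs'.le (h'.eltRank_nonneg _)), H, ofReal_measureReal]
  have hνμ : ν = μ := hμ.2 hν hν' hμν
  rw [← hνμ, measureReal_def, hνU U hU, ENNReal.toReal_ofReal (h.eltRank_nonneg _)]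

end IsSylvesterRank

end InvariantMeasure

end

noncomputable section

/-! ### Uniqueness of rank functions on commutative rings -/

section Uniqueness

open Matrix

variable {K : Type*} [Field K] {X : Type*} [TopologicalSpace X]

/-- `f` and the characteristic function of its support are multiples of each other, through the
pointwise inverse. -/
theorem IsSylvesterRank.eltRank_locallyConstant {ρ : MatrixFunction (LocallyConstant X K)}
    (h : IsSylvesterRank ρ) (f : LocallyConstant X K) : eltRank ρ f =
      eltRank ρ (LocallyConstant.charFn K
        ((f.isLocallyConstant.isClopen_fiber 0).compl : IsClopen (f ⁻¹' {0})ᶜ)) := by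
  classical
  set χ := LocallyConstant.charFn K
    ((f.isLocallyConstant.isClopen_fiber 0).compl : IsClopen (f ⁻¹' {0})ᶜ) with hχ
  have h1 : f = f * χ := by
    ext x
    by_cases hx : f x = 0 <;> simp [hχ, LocallyConstant.coe_charFn, hx]
  have h2 : χ = f⁻¹ * f := by
    ext x
    by_cases hx : f x = 0 <;> simp [hχ, LocallyConstant.coe_charFn, hx]
  apply le_antisymm
  · conv_lhs => rw [h1]
    exact h.eltRank_mul_le_right _ _
  · rw [h2]
    exact h.eltRank_mul_le_right _ _

/-- A rank function on `C_K(X)` is determined by its values on characteristic functions. -/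
theorem IsSylvesterRank.ext_locallyConstant {ρ ρ' : MatrixFunction (LocallyConstant X K)}
    (h : IsSylvesterRank ρ) (h' : IsSylvesterRank ρ')
    (H : ∀ (U : Set X) (hU : IsClopen U),
      eltRank ρ (LocallyConstant.charFn K hU) = eltRank ρ' (LocallyConstant.charFn K hU)) :
    ρ = ρ' := by
  refine h.ext_of_square h' fun n M => ?_
  have hdec : ∀ A : Matrix (Fin n) (Fin n) K, ∃ (P Q P' Q' : Matrix (Fin n) (Fin n) K)
      (d : Fin n → K), P * A * Q = diagonal d ∧ P' * diagonal d * Q' = A := by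
    intro A
    obtain ⟨_, _, _, d, rfl, ⟨U, rfl⟩, ⟨V, rfl⟩, rfl⟩ := exists_isUnit_mul_diagonal_mul A
    exact ⟨(U⁻¹ : (Matrix (Fin n) (Fin n) K)ˣ), (V⁻¹ : (Matrix (Fin n) (Fin n) K)ˣ), U, V, d,
      by simp only [Matrix.mul_assoc, Units.mul_inv, mul_one, Units.inv_mul_cancel_left], rfl⟩
  choose P Q P' Q' d h1 h2 using hdec
  -- Applied pointwise to `M`, the choices of diagonalizing matrices remain locally constant, so `M`
  -- is diagonalized over `C_K(X)` itself.
  let mm : LocallyConstant X (Matrix (Fin n) (Fin n) K) :=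
    LocallyConstant.unflip fun i => LocallyConstant.unflip fun j => M i j
  let lift (F : Matrix (Fin n) (Fin n) K → Matrix (Fin n) (Fin n) K) :
    Matrix (Fin n) (Fin n) (LocallyConstant X K) := Matrix.of fun i j => mm.map fun A => F A i j
  let ev (x : X) : LocallyConstant X K →+* K := LocallyConstant.evalRingHom x
  have hlift : ∀ F x, (lift F).map (ev x) = F (M.map (ev x)) := fun F x => rfl
  let dc : Fin n → LocallyConstant X K := fun i => mm.map fun A => d A i
  have hdc : ∀ x, (diagonal dc).map (ev x) = diagonal (d (M.map (ev x))) := fun x => by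
    rw [Matrix.diagonal_map (map_zero _)]
    rfl
  have hext : ∀ A B : Matrix (Fin n) (Fin n) (LocallyConstant X K),
      (∀ x, A.map (ev x) = B.map (ev x)) → A = B := fun A B hAB => by
    ext i j x
    exact congrFun (congrFun (hAB x) i) j
  have h3 : lift P * M * lift Q = diagonal dc := hext _ _ fun x => by
    rw [Matrix.map_mul, Matrix.map_mul, hlift, hlift, hdc, h1]
  have h4 : lift P' * diagonal dc * lift Q' = M := hext _ _ fun x => by
    rw [Matrix.map_mul, Matrix.map_mul, hlift, hlift, hdc, h2]
  rw [← h.fval_fin, ← h'.fval_fin, h.fval_eq_of_mul_eq _ _ _ _ h3 h4,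
    h'.fval_eq_of_mul_eq _ _ _ _ h3 h4, h.fval_diagonal, h'.fval_diagonal]
  refine Finset.sum_congr rfl fun i _ => ?_
  rw [h.eltRank_locallyConstant, h'.eltRank_locallyConstant, H]

/-- A rank function on a domain is determined if it is one on all nonzero elements. -/
theorem IsSylvesterRank.ext_domain {D : Type*} [CommRing D] [IsDomain D] {ρ ρ' : MatrixFunction D}
    (h : IsSylvesterRank ρ) (h' : IsSylvesterRank ρ') (hρ : ∀ d, d ≠ 0 → eltRank ρ d = 1)
    (hρ' : ∀ d, d ≠ 0 → eltRank ρ' d = 1) : ρ = ρ' := by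
  refine h.ext_of_square h' fun n M => ?_
  let F := FractionRing D
  let ι : D →+* F := algebraMap D F
  have hι : Function.Injective ι := IsFractionRing.injective D F
  have hinj : ∀ A B : Matrix (Fin n) (Fin n) D, A.map ι = B.map ι → A = B := fun A B hAB => by
    ext i j
    exact hι (congrFun (congrFun hAB i) j)
  have hclear : ∀ A : Matrix (Fin n) (Fin n) F, ∃ a : D, a ≠ 0 ∧
      ∃ A₀ : Matrix (Fin n) (Fin n) D, A₀.map ι = ι a • A := by
    intro A
    obtain ⟨a, ha⟩ := IsLocalization.exist_integer_multiples_of_finite (nonZeroDivisors D)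
      (fun p : Fin n × Fin n => A p.1 p.2)
    choose A₀ hA₀ using ha
    refine ⟨a, nonZeroDivisors.coe_ne_zero a, Matrix.of fun i j => A₀ (i, j), ?_⟩
    ext i j
    simpa [Algebra.smul_def, ι] using hA₀ (i, j)
  -- Diagonalize over the fraction field and clear denominators. The cleared transforming matrices
  -- are no longer invertible over `D`, but their products with the cleared inverses are nonzero
  -- scalars, so they have full rank and preserve ranks.
  obtain ⟨_, _, _, d, rfl, ⟨U, rfl⟩, ⟨V, rfl⟩, hM⟩ := exists_isUnit_mul_diagonal_mul (M.map ι)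
  obtain ⟨a, ha, A, hA⟩ := hclear U
  obtain ⟨a', ha', A', hA'⟩ := hclear (U⁻¹ : (Matrix (Fin n) (Fin n) F)ˣ)
  obtain ⟨b, hb, B, hB⟩ := hclear V
  obtain ⟨b', hb', B', hB'⟩ := hclear (V⁻¹ : (Matrix (Fin n) (Fin n) F)ˣ)
  have h1 : A' * A = diagonal fun _ => a' * a := hinj _ _ <| by
    rw [Matrix.map_mul, hA, hA', Matrix.diagonal_map (map_zero _), Matrix.smul_mul,
      Matrix.mul_smul, Units.inv_mul, smul_smul, smul_one_eq_diagonal, map_mul]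
  have h2 : B * B' = diagonal fun _ => b * b' := hinj _ _ <| by
    rw [Matrix.map_mul, hB, hB', Matrix.diagonal_map (map_zero _), Matrix.smul_mul,
      Matrix.mul_smul, Units.mul_inv, smul_smul, smul_one_eq_diagonal, map_mul]
  have h3 : A' * M * B' = diagonal fun i => (A' * M * B') i i := by
    have : (A' * M * B').map ι = diagonal fun i => ι a' * ι b' * d i := by
      rw [Matrix.map_mul, Matrix.map_mul, hA', hB', hM]
      simp only [Matrix.smul_mul, Matrix.mul_smul, smul_smul, Matrix.mul_assoc, Units.mul_inv,
        mul_one, Units.inv_mul_cancel_left]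
      ext i j
      by_cases hij : i = j <;> simp [hij, mul_comm]
    ext i j
    by_cases hij : i = j
    · simp [hij]
    · rw [Matrix.diagonal_apply_ne _ hij]
      apply hι
      have := congrFun (congrFun this i) j
      rwa [Matrix.diagonal_apply_ne _ hij, ← map_zero ι] at this
  have key : ∀ {σ : MatrixFunction D}, IsSylvesterRank σ → (∀ d, d ≠ 0 → eltRank σ d = 1) →
      σ n n M = ∑ i, eltRank σ ((A' * M * B') i i) := by
    intro σ hσ hσ1
    have hdiag : ∀ c : D, c ≠ 0 → fval σ (diagonal fun _ : Fin n => c) = Fintype.card (Fin n) := by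
      intro c hc
      rw [hσ.fval_diagonal]
      simp [hσ1 c hc]
    have hle : ∀ C : Matrix (Fin n) (Fin n) D, fval σ C ≤ Fintype.card (Fin n) := fun C => by
      have := hσ.fval_mul_le_left (1 : Matrix (Fin n) (Fin n) D) C
      rwa [Matrix.one_mul, hσ.fval_one] at this
    have hA1 : fval σ A' = Fintype.card (Fin n) := le_antisymm (hle _) <| by
      rw [← hdiag _ (mul_ne_zero ha' ha), ← h1]
      exact hσ.fval_mul_le_left _ _
    have hB1 : fval σ B' = Fintype.card (Fin n) := le_antisymm (hle _) <| by
      rw [← hdiag _ (mul_ne_zero hb hb'), ← h2]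
      exact hσ.fval_mul_le_right _ _
    rw [← hσ.fval_diagonal, ← h3, hσ.fval_mul_of_full_right _ hB1, hσ.fval_mul_of_full_left hA1,
      hσ.fval_fin]
  rw [key h hρ, key h' hρ']
  refine Finset.sum_congr rfl fun i _ => ?_
  by_cases h0 : (A' * M * B') i i = 0
  · rw [h0, h.eltRank_zero, h'.eltRank_zero]
  · rw [hρ _ h0, hρ' _ h0]

end Uniqueness

end

noncomputable section

/-! ### Height functions and cutting -/

section Cutting

open Matrix

/-- The cut matrix is a multiple of `M`; conversely, with `u = ∑ rₖ cₖ`, the matrix `u M u` is a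
multiple of the cut matrix and differs from `M` by entries of rank zero. Allowing `u` to be 1 only
up to rank zero is needed over a periodic orbit. -/
theorem IsSylvesterRank.fval_cut {R : Type*} [Ring R] {rk : MatrixFunction R}
    (h : IsSylvesterRank rk) {ι κ o : Type*} [Fintype ι] [Fintype κ] [Fintype o] (c r : o → R)
    (hu : eltRank rk (∑ k, r k * c k - 1) = 0) (M : Matrix ι κ R) :
    fval rk (Matrix.of fun (p : ι × o) (q : κ × o) => c p.2 * M p.1 q.1 * r q.2) = fval rk M := by
  classical
  set u := ∑ k, r k * c k with hu'
  set N : Matrix (ι × o) (κ × o) R :=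
    Matrix.of fun (p : ι × o) (q : κ × o) => c p.2 * M p.1 q.1 * r q.2 with hN
  apply le_antisymm
  · have : N = (Matrix.of fun (p : ι × o) i => if p.1 = i then c p.2 else 0) * M *
        (Matrix.of fun j (q : κ × o) => if q.1 = j then r q.2 else 0) := by
      ext p q
      simp [hN, Matrix.mul_apply]
    rw [this]
    exact (h.fval_mul_le_left _ _).trans (h.fval_mul_le_right _ _)
  · have h1 : fval rk M = fval rk (Matrix.of fun i j => u * M i j * u) := by
      refine h.fval_congr_of_eltRank_sub fun i j => le_antisymm ?_ (h.eltRank_nonneg _)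
      have h2 : M i j - u * M i j * u = -((u - 1) * (M i j * u) + M i j * (u - 1)) := by
        noncomm_ring
      simp only [Matrix.of_apply]
      rw [h2, h.eltRank_neg]
      refine (h.eltRank_add_le _ _).trans ?_
      linarith [h.eltRank_mul_le_left (u - 1) (M i j * u), h.eltRank_mul_le_right (M i j) (u - 1)]
    have h2 : (Matrix.of fun i j => u * M i j * u) =
        (Matrix.of fun i (p : ι × o) => if p.1 = i then r p.2 else 0) * N *
        (Matrix.of fun (q : κ × o) j => if q.1 = j then c q.2 else 0) := by
      ext i j
      simp only [hN, hu', Matrix.mul_apply, Matrix.of_apply, Fintype.sum_prod_type, ite_mul,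
        zero_mul, mul_ite, mul_zero, Finset.sum_mul, Finset.mul_sum, Finset.sum_ite_irrel,
        Finset.sum_const_zero, Finset.sum_ite_eq', Finset.mem_univ, if_true]
      rw [Finset.sum_comm]
      simp only [mul_assoc]
      exact Finset.sum_comm
    rw [h1, h2]
    exact (h.fval_mul_le_left _ _).trans (h.fval_mul_le_right _ _)

variable {K : Type*} [Field K] {X : Type*} [TopologicalSpace X]

/-- A locally constant function which drops by one along backward orbits until it reaches `0`. -/
structure IsHeight (T : X ≃ₜ X) (h : LocallyConstant X ℕ) : Prop where
  drop : ∀ x, h x ≠ 0 → h (T.symm x) + 1 = h x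

theorem zpow_sub_one_apply (T : X ≃ₜ X) (k : ℤ) (x : X) :
    (T ^ (k - 1) : X ≃ₜ X) x = T.symm ((T ^ k : X ≃ₜ X) x) := by
  rw [sub_eq_neg_add, _root_.zpow_add, _root_.zpow_neg_one]
  rfl

theorem zpow_add_apply (T : X ≃ₜ X) (k l : ℤ) (x : X) :
    (T ^ (k + l) : X ≃ₜ X) x = (T ^ k : X ≃ₜ X) ((T ^ l : X ≃ₜ X) x) := by
  rw [_root_.zpow_add]
  rfl

theorem IsHeight.eq_add {T : X ≃ₜ X} {h : LocallyConstant X ℕ} (hh : IsHeight T h) (n : ℕ) (x : X)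
    (hx : ∀ l < n, h ((T ^ (-(l : ℤ)) : X ≃ₜ X) x) ≠ 0) :
    h x = h ((T ^ (-(n : ℤ)) : X ≃ₜ X) x) + n := by
  induction n with
  | zero => simp
  | succ n ih =>
    rw [ih fun l hl => hx l (hl.trans (Nat.lt_succ_self n)), ← hh.drop _ (hx n (Nat.lt_succ_self n))]
    have : (-((n + 1 : ℕ) : ℤ)) = -(n : ℤ) - 1 := by push_cast; ring
    rw [this, zpow_sub_one_apply]
    ring

/-- The level sets of a height function. -/
def levelSet (h : LocallyConstant X ℕ) (i : ℕ) : Set X := h ⁻¹' {i}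

theorem isClopen_levelSet (h : LocallyConstant X ℕ) (i : ℕ) : IsClopen (levelSet h i) :=
  h.isLocallyConstant.isClopen_fiber i

/-- The characteristic function of a level set. -/
def levelFn (K : Type*) [Field K] (h : LocallyConstant X ℕ) (i : ℕ) : LocallyConstant X K :=
  LocallyConstant.charFn K (isClopen_levelSet h i)

open Classical in
theorem levelFn_apply (h : LocallyConstant X ℕ) (i : ℕ) (x : X) :
    levelFn K h i x = if h x = i then 1 else 0 := by
  simp [levelFn, LocallyConstant.coe_charFn, Set.indicator_apply, levelSet]

/-- The element `t⁻ⁱ χ_{h = i}`. -/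
def cutLeft (K : Type*) [Field K] (T : X ≃ₜ X) (h : LocallyConstant X ℕ) (i : ℕ) :
    DynCrossedProduct K T := mono T 1 (-(i : ℤ)) * mono T (levelFn K h i) 0

/-- The element `χ_{h = i} tⁱ`. -/
def cutRight (K : Type*) [Field K] (T : X ≃ₜ X) (h : LocallyConstant X ℕ) (i : ℕ) :
    DynCrossedProduct K T := mono T (levelFn K h i) i

/-- `cutLeft` carries level `i` down to the bottom and `cutRight` carries it back up; the products
are the orthogonal idempotents of the levels. -/
theorem cutRight_mul_cutLeft (T : X ≃ₜ X) (h : LocallyConstant X ℕ) (i : ℕ) :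
    cutRight K T h i * cutLeft K T h i = chi K T (isClopen_levelSet h i) := by
  rw [cutRight, cutLeft, mono_mul_mono, mono_mul_mono, chi, incl_eq_mono]
  simp only [add_zero, add_neg_cancel]
  congr 1
  ext x
  simp only [LocallyConstant.coe_mul, Pi.mul_apply, shift_apply, one_mul, neg_neg, ← zpow_add_apply, add_neg_cancel]
  change levelFn K h i x * levelFn K h i x = levelFn K h i x
  rw [levelFn_apply]
  simp

/-- The corner lies in `C_K(X)` if `i = j + k`, that is, when `g tᵏ` moves level `j` to level `i`
without breaking the tower. -/
theorem cutLeft_mul_mono_mul_cutRight (T : X ≃ₜ X) (h : LocallyConstant X ℕ) (i j : ℕ)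
    (g : LocallyConstant X K) (k : ℤ) : cutLeft K T h i * mono T g k * cutRight K T h j =
      mono T (shift T (-(i : ℤ)) (levelFn K h i * g * shift T k (levelFn K h j)))
        (k + j - i) := by
  rw [cutRight, cutLeft, mono_mul_mono, mono_mul_mono, mono_mul_mono]
  rw [show -(i : ℤ) + 0 + k + j = k + j - i by ring]
  congr 1
  ext x
  simp only [LocallyConstant.coe_mul, Pi.mul_apply, shift_apply, one_mul, neg_neg, ← zpow_add_apply, add_zero, neg_add_rev]

theorem sum_cutRight_mul_cutLeft [CompactSpace X] (T : X ≃ₜ X) (h : LocallyConstant X ℕ) {N : ℕ}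
    (hN : ∀ x, h x < N) :
    ∑ i : Fin N, cutRight K T h i * cutLeft K T h i = 1 := by
  simp only [cutRight_mul_cutLeft, chi]
  rw [← map_sum, ← map_one (CrossedProduct.incl (homeoAutomorphism K T))]
  congr 1
  ext x
  have : ∀ i : Fin N, LocallyConstant.charFn K (isClopen_levelSet h i) x =
      if (⟨h x, hN x⟩ : Fin N) = i then 1 else 0 := by
    intro i
    have := levelFn_apply (K := K) h i x
    rw [levelFn] at this
    rw [this]
    simp [Fin.ext_iff]
  rw [← LocallyConstant.coeFnRingHom_apply, map_sum, Finset.sum_apply]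
  simp [this]

end Cutting

end

noncomputable section

/-! ### Uniqueness in the presence of small complete sections -/

section SmallSections

open Matrix

variable {K : Type*} [Field K] {X : Type*} [TopologicalSpace X] {T : X ≃ₜ X}

theorem IsSylvesterRank.eltRank_mono_le {rk : MatrixFunction (DynCrossedProduct K T)}
    (h : IsSylvesterRank rk) (f : LocallyConstant X K) (k : ℤ) :
    eltRank rk (mono T f k) ≤
      eltRank rk (chi K T (f.isLocallyConstant.isClopen_fiber 0).compl) := by
  have : mono T f k = chi K T (f.isLocallyConstant.isClopen_fiber 0).compl * mono T f k := by
    rw [chi, incl_eq_mono, mono_mul_mono, zero_add]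
    congr 1
    ext x
    by_cases hx : f x = 0 <;> simp [LocallyConstant.coe_charFn, hx]
  rw [this]
  exact h.eltRank_mul_le_left _ _

variable [MeasurableSpace X] [BorelSpace X]

/-- The points whose heights differ from those of their `k`-th translates by more than `k`. -/
def badSet (T : X ≃ₜ X) (h : LocallyConstant X ℕ) (k : ℤ) : Set X :=
  {y | ¬ (h y : ℤ) = h ((T ^ (-k) : X ≃ₜ X) y) + k}

omit [MeasurableSpace X] [BorelSpace X] in
theorem isClopen_badSet (T : X ≃ₜ X) (h : LocallyConstant X ℕ) (k : ℤ) :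
    IsClopen (badSet T h k) := by
  let F : LocallyConstant X (ℕ × ℕ) :=
    ⟨fun y => (h y, h ((T ^ (-k) : X ≃ₜ X) y)), by
      have h2 : IsLocallyConstant fun y => h ((T ^ (-k) : X ≃ₜ X) y) :=
        h.isLocallyConstant.comp_continuous (T ^ (-k) : X ≃ₜ X).continuous
      exact h.isLocallyConstant.prodMk h2⟩
  have : badSet T h k = F ⁻¹' {p | ¬ (p.1 : ℤ) = p.2 + k} := rfl
  rw [this]
  exact ⟨⟨F.isLocallyConstant {p | ¬ (p.1 : ℤ) = p.2 + k}ᶜ⟩, F.isLocallyConstant _⟩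

/-- Height changes by exactly `k` unless the `|k|` steps between `y` and `T⁻ᵏy` meet the bottom
level, so the bad set is covered by `|k|` translates of the bottom. -/
theorem measureReal_badSet_le {μ : Measure X} [IsProbabilityMeasure μ]
    (hT : MeasurePreserving T μ μ) {h : LocallyConstant X ℕ} (hh : IsHeight T h) (k : ℤ) :
    μ.real (badSet T h k) ≤ k.natAbs * μ.real (levelSet h 0) := by
  -- Heights are compared going backward, so for `k < 0` the descent starts at `T⁻ᵏy` and ends at
  -- `y`.
  let c : ℤ := if 0 ≤ k then 0 else k.natAbs
  have hsub : badSet T h k ⊆ ⋃ l ∈ Finset.range k.natAbs,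
      (T ^ (c - (l : ℤ)) : X ≃ₜ X) ⁻¹' levelSet h 0 := by
    intro y hy
    by_contra hcon
    simp only [Set.mem_iUnion, Finset.mem_range, Set.mem_preimage, not_exists] at hcon
    apply hy
    by_cases hk : 0 ≤ k
    · have hc : c = 0 := if_pos hk
      have := hh.eq_add k.natAbs y fun l hl h0 => hcon l hl (by rw [hc, zero_sub]; exact h0)
      rw [Int.natAbs_of_nonneg hk] at this
      omega
    · have hc : c = k.natAbs := if_neg hk
      have hc' : c = -k := by omega
      have := hh.eq_add k.natAbs ((T ^ c : X ≃ₜ X) y) fun l hl h0 => hcon l hl (by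
        rw [sub_eq_neg_add, zpow_add_apply]; exact h0)
      rw [← zpow_add_apply, ← hc, neg_add_cancel, hc'] at this
      change h ((T ^ (-k) : X ≃ₜ X) y) = h y + k.natAbs at this
      omega
  have hmeas : ∀ l : ℕ, μ.real ((T ^ (c - (l : ℤ)) : X ≃ₜ X) ⁻¹' levelSet h 0) =
      μ.real (levelSet h 0) := fun l =>
    (measurePreserving_zpow T hT _).measureReal_preimage
      (isClopen_levelSet h 0).isOpen.measurableSet.nullMeasurableSet
  calc μ.real (badSet T h k) ≤ μ.real (⋃ l ∈ Finset.range k.natAbs,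
        (T ^ (c - (l : ℤ)) : X ≃ₜ X) ⁻¹' levelSet h 0) :=
        measureReal_mono hsub (measure_ne_top _ _)
    _ ≤ ∑ l ∈ Finset.range k.natAbs, μ.real ((T ^ (c - (l : ℤ)) : X ≃ₜ X) ⁻¹' levelSet h 0) :=
        measureReal_biUnion_finset_le _ _
    _ = k.natAbs * μ.real (levelSet h 0) := by simp [hmeas]

/-- Elements of the crossed product can be approximated by elements not crossing the bottom level
of a height function. -/
theorem exists_cut_approximation {μ : Measure X} [IsProbabilityMeasure μ]
    (hT : MeasurePreserving T μ μ) (a : DynCrossedProduct K T) :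
    ∃ C : ℝ, 0 ≤ C ∧ ∀ h : LocallyConstant X ℕ, IsHeight T h → ∃ a' : DynCrossedProduct K T,
      (∀ rk : MatrixFunction (DynCrossedProduct K T), IsSylvesterRank rk →
        (∀ (U : Set X) (hU : IsClopen U), eltRank rk (chi K T hU) = μ.real U) →
          eltRank rk (a - a') ≤ C * μ.real (levelSet h 0)) ∧
      ∀ i j : ℕ, ∃ f : LocallyConstant X K,
        cutLeft K T h i * a' * cutRight K T h j =
          CrossedProduct.incl (homeoAutomorphism K T) f := by
  induction a using crossed_induction with
  | zero =>
    refine ⟨0, le_rfl, fun h _ => ⟨0, fun rk hrk _ => ?_, fun i j => ⟨0, by simp⟩⟩⟩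
    rw [sub_zero, hrk.eltRank_zero, zero_mul]
  | add a b ha hb =>
    obtain ⟨C, hC, H⟩ := ha
    obtain ⟨C', hC', H'⟩ := hb
    refine ⟨C + C', add_nonneg hC hC', fun h hh => ?_⟩
    obtain ⟨a', h1, h2⟩ := H h hh
    obtain ⟨b', h1', h2'⟩ := H' h hh
    refine ⟨a' + b', fun rk hrk hU => ?_, fun i j => ?_⟩
    · rw [add_sub_add_comm, add_mul]
      exact (hrk.eltRank_add_le _ _).trans (add_le_add (h1 rk hrk hU) (h1' rk hrk hU))
    · obtain ⟨f, hf⟩ := h2 i j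
      obtain ⟨f', hf'⟩ := h2' i j
      exact ⟨f + f', by rw [map_add, mul_add, add_mul, hf, hf']⟩
  | mono f k =>
    refine ⟨k.natAbs, by positivity, fun h hh => ?_⟩
    have hcl := isClopen_badSet T h k
    -- Delete the part of `f` over the bad set, whose measure is at most `|k|` times that of the
    -- bottom.
    refine ⟨mono T (f - LocallyConstant.charFn K hcl * f) k, fun rk hrk hU => ?_, fun i j => ?_⟩
    · have : mono T f k - mono T (f - LocallyConstant.charFn K hcl * f) k =
          chi K T hcl * mono T f k := by
        rw [mono_sub, sub_sub_cancel, chi, incl_eq_mono, mono_mul_mono, zero_add]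
        congr 1
      rw [this]
      refine (hrk.eltRank_mul_le_left _ _).trans ?_
      rw [hU]
      exact measureReal_badSet_le hT hh k
    · rw [cutLeft_mul_mono_mul_cutRight]
      by_cases hkij : k + j - i = 0
      · exact ⟨_, by rw [hkij, incl_eq_mono]⟩
      · refine ⟨0, ?_⟩
        -- A point at level `i` whose translate `T⁻ᵏx` is at level `j ≠ i - k` is bad, and there the
        -- truncated function vanishes.
        have : levelFn K h i * (f - LocallyConstant.charFn K hcl * f) *
            shift T k (levelFn K h j) = 0 := by
          classical
          ext x
          simp only [LocallyConstant.coe_mul, Pi.mul_apply, shift_apply, levelFn_apply,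
            LocallyConstant.coe_sub, Pi.sub_apply, LocallyConstant.coe_charFn,
            LocallyConstant.coe_zero, Pi.zero_apply]
          by_cases h1 : h x = i
          · by_cases h2 : h ((T ^ (-k) : X ≃ₜ X) x) = j
            · have : x ∈ badSet T h k := by
                simp only [badSet, Set.mem_ofPred_eq]
                omega
              simp [this]
            · rw [if_neg h2, mul_zero]
          · rw [if_neg h1, zero_mul, zero_mul]
        rw [this, map_zero]
        have h0 : shift T (-(i : ℤ)) (0 : LocallyConstant X K) = 0 := by ext x; simp
        rw [h0, mono_zero]

/-- If there are height functions with arbitrarily small bottom level, then a rank function is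
determined by its values on the characteristic functions of clopen sets. -/
theorem rank_unique_of_small_sections [CompactSpace X] {μ : Measure X} [IsProbabilityMeasure μ]
    (hT : MeasurePreserving T μ μ)
    (hsmall : ∀ ε > 0, ∃ h : LocallyConstant X ℕ, IsHeight T h ∧ μ.real (levelSet h 0) < ε)
    {rk rk' : MatrixFunction (DynCrossedProduct K T)} (hrk : IsSylvesterRank rk)
    (hrk' : IsSylvesterRank rk')
    (hU : ∀ (U : Set X) (hU : IsClopen U), eltRank rk (chi K T hU) = μ.real U)
    (hU' : ∀ (U : Set X) (hU : IsClopen U), eltRank rk' (chi K T hU) = μ.real U) :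
    rk = rk' := by
  funext m n M
  choose C hC H using fun a : DynCrossedProduct K T => exists_cut_approximation hT a
  -- This bound does not depend on the height function, so the base can be shrunk afterwards.
  set c : ℝ := ∑ i, ∑ j, C (M i j) with hc
  have hc0 : 0 ≤ c := Finset.sum_nonneg fun i _ => Finset.sum_nonneg fun j _ => hC _
  have key : ∀ ε > 0, |rk m n M - rk' m n M| ≤ 2 * c * ε := by
    intro ε hε
    obtain ⟨h, hh, hμ⟩ := hsmall ε hε
    choose a' h1 h2 using fun a => H a h hh
    choose f hf using h2
    obtain ⟨N, hN⟩ : ∃ N, ∀ x, h x < N := by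
      obtain ⟨N, hN⟩ := h.range_finite.bddAbove
      exact ⟨N + 1, fun x => Nat.lt_succ_of_le (hN ⟨x, rfl⟩)⟩
    let M' : Matrix (Fin m) (Fin n) (DynCrossedProduct K T) := Matrix.of fun i j => a' (M i j)
    let P : Matrix (Fin m × Fin N) (Fin n × Fin N) (LocallyConstant X K) :=
      Matrix.of fun p q => f (M p.1 q.1) p.2 q.2
    have hM' : ∀ {σ : MatrixFunction (DynCrossedProduct K T)}, IsSylvesterRank σ →
        fval σ M' = fval (fun m n (M : Matrix (Fin m) (Fin n) (LocallyConstant X K)) =>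
          σ m n (M.map (CrossedProduct.incl (homeoAutomorphism K T)))) P := by
      intro σ hσ
      rw [IsSylvesterRank.fval_pullback, ← hσ.fval_cut
        (fun i : Fin N => cutLeft K T h i) (fun i : Fin N => cutRight K T h i)
        (by rw [sum_cutRight_mul_cutLeft T h hN, sub_self, hσ.eltRank_zero])]
      congr 1
      ext p q
      exact hf _ _ _
    -- The cut matrix has entries in `C_K(X)`, where `μ` determines the rank.
    have hpull : (fun m n (M : Matrix (Fin m) (Fin n) (LocallyConstant X K)) =>
          rk m n (M.map (CrossedProduct.incl (homeoAutomorphism K T)))) =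
        (fun m n (M : Matrix (Fin m) (Fin n) (LocallyConstant X K)) =>
          rk' m n (M.map (CrossedProduct.incl (homeoAutomorphism K T)))) :=
      (hrk.pullback _).ext_locallyConstant (hrk'.pullback _) fun U hUU => by
        rw [IsSylvesterRank.eltRank_pullback, IsSylvesterRank.eltRank_pullback]
        exact (hU U hUU).trans (hU' U hUU).symm
    have heq : fval rk M' = fval rk' M' := by rw [hM' hrk, hM' hrk', hpull]
    have hdist : ∀ {σ : MatrixFunction (DynCrossedProduct K T)}, IsSylvesterRank σ →
        (∀ (U : Set X) (hU : IsClopen U), eltRank σ (chi K T hU) = μ.real U) →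
        |fval σ M - fval σ M'| ≤ c * ε := by
      intro σ hσ hσU
      refine (hσ.abs_fval_sub_le M M').trans ((hσ.fval_le_sum_eltRank _).trans ?_)
      rw [hc, Finset.sum_mul]
      refine Finset.sum_le_sum fun i _ => ?_
      rw [Finset.sum_mul]
      refine Finset.sum_le_sum fun j _ => ?_
      exact (h1 (M i j) σ hσ hσU).trans (mul_le_mul_of_nonneg_left hμ.le (hC _))
    rw [← hrk.fval_fin, ← hrk'.fval_fin]
    have e1 := abs_le.1 (hdist hrk hU)
    have e2 := abs_le.1 (hdist hrk' hU')
    rw [heq] at e1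
    exact abs_le.2 ⟨by linarith, by linarith⟩
  have : |rk m n M - rk' m n M| ≤ 0 := by
    refine le_of_forall_pos_le_add fun δ hδ => ?_
    refine (key (δ / (2 * c + 1)) (by positivity)).trans ?_
    rw [zero_add, mul_div_assoc', div_le_iff₀ (by positivity)]
    nlinarith
  exact sub_eq_zero.1 (abs_nonpos_iff.1 this)

end SmallSections

end

noncomputable section

/-! ### Existence of height functions -/

section Heights

open Filter Topology

variable {X : Type*} [TopologicalSpace X] {T : X ≃ₜ X}

/-- The height function counting the time since the last visit to a clopen set. -/
theorem exists_isHeight {W : Set X} (hW : IsClopen W)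
    (hcov : ∀ x, ∃ j : ℕ, (T ^ (-(j : ℤ)) : X ≃ₜ X) x ∈ W) :
    ∃ h : LocallyConstant X ℕ, IsHeight T h ∧ levelSet h 0 = W := by
  classical
  let F : X → ℕ := fun x => Nat.find (hcov x)
  have hF : IsLocallyConstant F := by
    refine IsLocallyConstant.iff_isOpen_fiber.2 fun i => ?_
    have h1 : F ⁻¹' {i} = (T ^ (-(i : ℤ)) : X ≃ₜ X) ⁻¹' W ∩
        ⋂ j ∈ Finset.range i, ((T ^ (-(j : ℤ)) : X ≃ₜ X) ⁻¹' W)ᶜ := by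
      ext x
      simp [F, Nat.find_eq_iff]
    rw [h1]
    exact (hW.isOpen.preimage (T ^ (-(i : ℤ)) : X ≃ₜ X).continuous).inter
      (isOpen_biInter_finset fun j _ =>
        (hW.isClosed.preimage (T ^ (-(j : ℤ)) : X ≃ₜ X).continuous).isOpen_compl)
  refine ⟨⟨F, hF⟩, ⟨fun x hx => ?_⟩, ?_⟩
  · change Nat.find (hcov (T.symm x)) + 1 = Nat.find (hcov x)
    have hx' : Nat.find (hcov x) ≠ 0 := hx
    have hstep : ∀ j : ℕ, (T ^ (-(j : ℤ)) : X ≃ₜ X) (T.symm x) =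
        (T ^ (-((j + 1 : ℕ) : ℤ)) : X ≃ₜ X) x := fun j => by
      have h1 := zpow_sub_one_apply T 0 x
      have h2 : (-((j + 1 : ℕ) : ℤ)) = -(j : ℤ) + (0 - 1) := by push_cast; ring
      rw [h2, zpow_add_apply, h1]
      rfl
    have h0 : ¬ (T ^ (-((0 : ℕ) : ℤ)) : X ≃ₜ X) x ∈ W := fun h =>
      hx' ((Nat.find_eq_zero _).2 h)
    rw [Nat.find_comp_succ (hcov x) (by
      obtain ⟨j, hj⟩ := hcov (T.symm x)
      exact ⟨j, by rwa [hstep] at hj⟩) h0]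
    simp only [hstep]
  · ext x
    exact Nat.find_eq_zero (hcov x)

/-- A clopen set can be enlarged to a complete section by the set of points whose first `N`
backward iterates avoid it. -/
theorem exists_isHeight_union {V : Set X} (hV : IsClopen V) (N : ℕ) :
    ∃ h : LocallyConstant X ℕ, IsHeight T h ∧
      levelSet h 0 = V ∪ ⋂ j ∈ Finset.range N, ((T ^ (-(j : ℤ)) : X ≃ₜ X) ⁻¹' V)ᶜ := by
  have hY : IsClopen (⋂ j ∈ Finset.range N, ((T ^ (-(j : ℤ)) : X ≃ₜ X) ⁻¹' V)ᶜ) :=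
    isClopen_biInter_finset fun j _ =>
      (hV.preimage (T ^ (-(j : ℤ)) : X ≃ₜ X).continuous).compl
  refine exists_isHeight (hV.union hY) fun x => ?_
  by_cases hx : ∃ j < N, (T ^ (-(j : ℤ)) : X ≃ₜ X) x ∈ V
  · obtain ⟨j, -, hj⟩ := hx
    exact ⟨j, Or.inl hj⟩
  · refine ⟨0, Or.inr ?_⟩
    push Not at hx
    simpa using hx

variable [CompactSpace X] [T2Space X] [TotallyDisconnectedSpace X] [MeasurableSpace X]
  [BorelSpace X]

/-- Take a small clopen neighbourhood `V` of `x`. By ergodicity almost every backward orbit visits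
`V`, so the points avoiding it for `N` steps have small measure for large `N`. Adding them to `V`
gives a clopen base which every backward orbit meets. -/
theorem exists_small_height {μ : Measure X} [IsProbabilityMeasure μ] [μ.OuterRegular]
    (hT : Ergodic T μ) {x : X} (hx : ∀ U ∈ 𝓝 x, 0 < μ U) (h0 : μ {x} = 0) {ε : ℝ} (hε : 0 < ε) :
    ∃ h : LocallyConstant X ℕ, IsHeight T h ∧ μ.real (levelSet h 0) < ε := by
  obtain ⟨U, hxU, hU, hμU⟩ := Set.exists_isOpen_lt_of_lt {x} (ENNReal.ofReal (ε / 2))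
    (by rw [h0]; simpa using hε)
  obtain ⟨V, hV, hxV, hVU⟩ := compact_exists_isClopen_in_isOpen hU (hxU rfl)
  have hμV : μ.real V < ε / 2 := by
    rw [measureReal_def]
    exact ENNReal.toReal_lt_of_lt_ofReal ((measure_mono hVU).trans_lt hμU)
  let Y : ℕ → Set X := fun N => ⋂ j ∈ Finset.range N, ((T ^ (-(j : ℤ)) : X ≃ₜ X) ⁻¹' V)ᶜ
  have hYm : ∀ N, MeasurableSet (Y N) := fun N =>
    Finset.measurableSet_biInter _ fun j _ =>
      ((hV.isOpen.preimage (T ^ (-(j : ℤ)) : X ≃ₜ X).continuous).measurableSet).compl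
  let Z : Set X := ⋃ j : ℕ, (T ^ (-(j : ℤ)) : X ≃ₜ X) ⁻¹' V
  have hZm : MeasurableSet Z := MeasurableSet.iUnion fun j =>
    (hV.isOpen.preimage (T ^ (-(j : ℤ)) : X ≃ₜ X).continuous).measurableSet
  have hZT : Z ⊆ T ⁻¹' Z := by
    intro y hy
    obtain ⟨j, hj⟩ := Set.mem_iUnion.1 hy
    refine Set.mem_iUnion.2 ⟨j + 1, ?_⟩
    have : (-((j + 1 : ℕ) : ℤ)) = -(j : ℤ) + (-1) := by push_cast; ring
    rw [Set.mem_preimage, this, zpow_add_apply, _root_.zpow_neg_one]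
    change (T ^ (-(j : ℤ)) : X ≃ₜ X) (T.symm (T y)) ∈ V
    rwa [Homeomorph.symm_apply_apply]
  have hVZ : V ⊆ Z := fun y hy => Set.mem_iUnion.2 ⟨0, hy⟩
  have hZ : μ Zᶜ = 0 := by
    rcases hT.ae_empty_or_univ_of_ae_le_preimage hZm.nullMeasurableSet
      (Filter.Eventually.of_forall hZT) with h | h
    · have h1 := hx V (hV.isOpen.mem_nhds hxV)
      have h2 : μ Z = 0 := by rw [measure_congr h, measure_empty]
      exact absurd (measure_mono_null hVZ h2) h1.ne'
    · exact ae_eq_univ.1 h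
  have hlim : Tendsto (μ ∘ Y) atTop (𝓝 (μ (⋂ N, Y N))) :=
    tendsto_measure_iInter_atTop (fun N => (hYm N).nullMeasurableSet)
      (fun M N hMN => Set.biInter_subset_biInter_left fun j hj =>
        Finset.mem_range.2 (lt_of_lt_of_le (Finset.mem_range.1 hj) hMN)) ⟨0, measure_ne_top _ _⟩
  have hYZ : (⋂ N, Y N) ⊆ Zᶜ := by
    intro y hy hyZ
    obtain ⟨j, hj⟩ := Set.mem_iUnion.1 hyZ
    have := Set.mem_iInter.1 hy (j + 1)
    simp only [Y, Set.mem_iInter, Finset.mem_range] at this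
    exact this j (Nat.lt_succ_self j) hj
  rw [measure_mono_null hYZ hZ] at hlim
  obtain ⟨N, hN⟩ := (hlim.eventually (gt_mem_nhds
    (show (0 : ℝ≥0∞) < ENNReal.ofReal (ε / 2) by simpa using hε))).exists
  obtain ⟨h, hh, hlev⟩ := exists_isHeight_union (T := T) hV N
  refine ⟨h, hh, ?_⟩
  rw [hlev]
  refine (measureReal_union_le _ _).trans_lt ?_
  have : μ.real (Y N) < ε / 2 := by
    rw [measureReal_def]
    exact ENNReal.toReal_lt_of_lt_ofReal hN
  calc _ < ε / 2 + ε / 2 := add_lt_add hμV this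
    _ = ε := by ring

omit [CompactSpace X] [T2Space X] [TotallyDisconnectedSpace X] in
/-- An atom of an invariant probability measure is a periodic point. -/
theorem exists_period {μ : Measure X} [IsProbabilityMeasure μ] [T1Space X]
    (hT : MeasurePreserving T μ μ) {x : X} (h0 : μ {x} ≠ 0) :
    ∃ p : ℕ, 0 < p ∧ ∀ k : ℤ, (T ^ k : X ≃ₜ X) x = x ↔ (p : ℤ) ∣ k := by
  classical
  have hiter : ∀ (n : ℕ), (T ^ (n : ℤ) : X ≃ₜ X) x = T^[n] x := fun n => by
    induction n with
    | zero => rfl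
    | succ n ih =>
      rw [Function.iterate_succ_apply', ← ih, Nat.cast_add, Nat.cast_one, add_comm, zpow_add_apply,
        zpow_one]
  -- Poincaré recurrence returns some point of `{x}`, hence `x`, to itself.
  obtain ⟨y, hy, m, hm, hmy⟩ := hT.conservative.exists_mem_iterate_mem
    (measurableSet_singleton x).nullMeasurableSet h0
  rw [Set.mem_singleton_iff] at hy hmy
  subst hy
  have hex : ∃ n : ℕ, 0 < n ∧ (T ^ (n : ℤ) : X ≃ₜ X) y = y :=
    ⟨m, Nat.pos_of_ne_zero hm, by rw [hiter, hmy]⟩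
  obtain ⟨hp0, hp⟩ := Nat.find_spec hex
  set p := Nat.find hex with hpdef
  have hmul : ∀ q : ℤ, (T ^ ((p : ℤ) * q) : X ≃ₜ X) y = y := by
    have hneg : (T ^ (-(p : ℤ)) : X ≃ₜ X) y = y := by
      conv_lhs => rw [← hp]
      rw [← zpow_add_apply, neg_add_cancel]
      rfl
    intro q
    induction q using Int.induction_on with
    | zero => simp
    | succ n ih => rw [mul_add, mul_one, zpow_add_apply, hp, ih]
    | pred n ih => rw [mul_sub, mul_one, sub_eq_add_neg, zpow_add_apply, hneg, ih]
  refine ⟨p, hp0, fun k => ⟨fun hk => ?_, fun ⟨q, hq⟩ => hq ▸ hmul q⟩⟩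
  have hpz : (0 : ℤ) < p := by exact_mod_cast hp0
  have hmod : (T ^ (k % p) : X ≃ₜ X) y = y := by
    have : k = k % p + p * (k / p) := (Int.emod_add_mul_ediv k p).symm
    rw [this, zpow_add_apply, hmul] at hk
    exact hk
  by_contra hdvd
  have h1 : 0 < k % p := lt_of_le_of_ne (Int.emod_nonneg _ hpz.ne')
    fun h => hdvd (Int.dvd_of_emod_eq_zero h.symm)
  have h2 : k % p < p := Int.emod_lt_of_pos _ hpz
  have h3 : ((k % p).toNat : ℤ) = k % p := Int.toNat_of_nonneg h1.le
  exact Nat.find_min hex (m := (k % p).toNat) (by omega) ⟨by omega, by rw [h3]; exact hmod⟩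

omit [CompactSpace X] [T2Space X] [TotallyDisconnectedSpace X] in
/-- An ergodic measure with an atom is concentrated on the orbit of the atom. -/
theorem measure_compl_orbit {μ : Measure X} [IsProbabilityMeasure μ] [T1Space X]
    (hT : Ergodic T μ) {x : X} (h0 : μ {x} ≠ 0) :
    μ {y | ∀ k : ℤ, y ≠ (T ^ k : X ≃ₜ X) x} = 0 := by
  have hO : {y | ∀ k : ℤ, y ≠ (T ^ k : X ≃ₜ X) x} = (⋃ k : ℤ, {(T ^ k : X ≃ₜ X) x})ᶜ := by
    ext y; simp [eq_comm]
  rw [hO]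
  have hm : MeasurableSet (⋃ k : ℤ, {(T ^ k : X ≃ₜ X) x}) :=
    MeasurableSet.iUnion fun k => measurableSet_singleton _
  have hinv : T ⁻¹' (⋃ k : ℤ, {(T ^ k : X ≃ₜ X) x}) = ⋃ k : ℤ, {(T ^ k : X ≃ₜ X) x} := by
    ext y
    simp only [Set.mem_preimage, Set.mem_iUnion, Set.mem_singleton_iff]
    constructor
    · rintro ⟨k, hk⟩
      exact ⟨k - 1, by rw [zpow_sub_one_apply, ← hk, Homeomorph.symm_apply_apply]⟩
    · rintro ⟨k, rfl⟩
      exact ⟨1 + k, by rw [zpow_add_apply, zpow_one]⟩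
  refine (hT.measure_self_or_compl_eq_zero hm hinv).resolve_left fun h => h0 ?_
  exact measure_mono_null (Set.singleton_subset_iff.2 (Set.mem_iUnion.2 ⟨0, rfl⟩)) h

omit [MeasurableSpace X] [BorelSpace X] in
/-- A height function whose bottom level meets a periodic orbit in a single point. -/
theorem exists_height_of_periodic {x : X} {p : ℕ} (hp0 : 0 < p)
    (hp : ∀ k : ℤ, (T ^ k : X ≃ₜ X) x = x ↔ (p : ℤ) ∣ k) :
    ∃ h : LocallyConstant X ℕ, IsHeight T h ∧
      ∀ k : ℤ, h ((T ^ k : X ≃ₜ X) x) = (k % p).toNat := by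
  classical
  have hpz : (0 : ℤ) < p := by exact_mod_cast hp0
  have hmod : ∀ k : ℤ, (T ^ k : X ≃ₜ X) x = (T ^ (k % p) : X ≃ₜ X) x := fun k => by
    conv_lhs => rw [(Int.emod_add_mul_ediv k p).symm, zpow_add_apply, (hp _).2 (dvd_mul_right _ _)]
  let S : Finset X := (Finset.Ioo 0 (p : ℤ)).image fun k => (T ^ k : X ≃ₜ X) x
  have hxS : x ∈ (S : Set X)ᶜ := by
    intro hx
    simp only [S, Finset.coe_image, Set.mem_image, Finset.coe_Ioo, Set.mem_Ioo] at hx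
    obtain ⟨k, ⟨hk0, hkp⟩, hk⟩ := hx
    have := Int.le_of_dvd hk0 ((hp k).1 hk)
    omega
  obtain ⟨V, hV, hxV, hVS⟩ := compact_exists_isClopen_in_isOpen
    (S.finite_toSet.isClosed.isOpen_compl) hxS
  have hVk : ∀ k : ℤ, (T ^ k : X ≃ₜ X) x ∈ V ↔ (p : ℤ) ∣ k := by
    intro k
    refine ⟨fun hk => ?_, fun hk => by rwa [(hp k).2 hk]⟩
    by_contra hdvd
    rw [hmod] at hk
    refine hVS hk ?_
    simp only [S, Finset.coe_image, Set.mem_image, Finset.coe_Ioo, Set.mem_Ioo]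
    exact ⟨k % p, ⟨lt_of_le_of_ne (Int.emod_nonneg _ hpz.ne')
      fun h => hdvd (Int.dvd_of_emod_eq_zero h.symm), Int.emod_lt_of_pos _ hpz⟩, rfl⟩
  -- With `p` backward steps every orbit point reaches `x`, so the points added to `V` avoid the
  -- orbit.
  obtain ⟨h, hh, hlev⟩ := exists_isHeight_union (T := T) hV p
  have hzero : ∀ k : ℤ, h ((T ^ k : X ≃ₜ X) x) = 0 ↔ (p : ℤ) ∣ k := by
    intro k
    rw [← hVk]
    change (T ^ k : X ≃ₜ X) x ∈ levelSet h 0 ↔ _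
    rw [hlev]
    refine ⟨fun hk => hk.resolve_right fun hk' => ?_, Or.inl⟩
    simp only [Set.mem_iInter, Finset.mem_range, Set.mem_compl_iff, Set.mem_preimage] at hk'
    have h1 : 0 ≤ k % p := Int.emod_nonneg _ hpz.ne'
    have h2 : k % p < p := Int.emod_lt_of_pos _ hpz
    refine hk' (k % p).toNat (by omega) ?_
    rw [← zpow_add_apply, hVk, Int.toNat_of_nonneg h1]
    have := Int.emod_add_mul_ediv k p
    exact ⟨k / p, by linarith⟩
  refine ⟨h, hh, fun k => ?_⟩
  have hnat : ∀ j : ℕ, j < p → h ((T ^ (j : ℤ) : X ≃ₜ X) x) = j := by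
    intro j
    induction j with
    | zero => intro _; exact (hzero _).2 (by simp)
    | succ j ih =>
      intro hj
      have hne : h ((T ^ ((j + 1 : ℕ) : ℤ) : X ≃ₜ X) x) ≠ 0 := fun h0 => by
        have := Int.le_of_dvd (by positivity) ((hzero _).1 h0)
        omega
      rw [← hh.drop _ hne, ← zpow_sub_one_apply]
      have : ((j + 1 : ℕ) : ℤ) - 1 = j := by push_cast; ring
      rw [this, ih (by omega)]
  have h1 : 0 ≤ k % p := Int.emod_nonneg _ hpz.ne'
  have h2 : k % p < p := Int.emod_lt_of_pos _ hpz
  rw [hmod]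
  conv_lhs => rw [← Int.toNat_of_nonneg h1]
  exact hnat _ (by omega)

end Heights

end

noncomputable section

/-! ### Uniqueness over a periodic orbit -/

section Periodic

open Matrix

variable {K : Type*} [Field K] {X : Type*} [TopologicalSpace X]

/-- The homomorphism `K[t, t⁻¹] → C_K(X) ⋊ ℤ` sending `t` to `tᵖ`. -/
def cyclicHom (K : Type*) [Field K] {X : Type*} [TopologicalSpace X] (T : X ≃ₜ X) (p : ℕ) :
    LaurentPolynomial K →+* DynCrossedProduct K T :=
  AddMonoidAlgebra.liftNCRingHom
    ((CrossedProduct.incl (homeoAutomorphism K T)).comp LocallyConstant.constRingHom)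
    { toFun := fun n => mono T 1 (p * n.toAdd)
      map_one' := by simp [mono_one_zero]
      map_mul' := fun m n => by simp [mono_one_mul_mono_one, mul_add] }
    -- Constant functions are `T`-invariant, hence commute with powers of `t`.
    (fun a n => by
      simp only [RingHom.comp_apply, incl_eq_mono, MonoidHom.coe_mk, OneHom.coe_mk, Commute,
        SemiconjBy, mono_mul_mono]
      rw [zero_add, add_zero]
      congr 1
      ext x
      simp)

theorem cyclicHom_single (T : X ≃ₜ X) (p : ℕ) (n : ℤ) (a : K) :
    cyclicHom K T p (AddMonoidAlgebra.single n a) = mono T (LocallyConstant.const X a) (p * n) := by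
  refine (AddMonoidAlgebra.liftNC_single _ _ n a).trans ?_
  change mono T (LocallyConstant.const X a) 0 * mono T 1 (p * n) = _
  rw [mono_mul_mono, zero_add]
  congr 1
  ext x
  simp

theorem laurent_induction {motive : LaurentPolynomial K → Prop} (q : LaurentPolynomial K)
    (add : ∀ q r, motive q → motive r → motive (q + r))
    (single : ∀ n a, motive (AddMonoidAlgebra.single n a)) : motive q :=
  LaurentPolynomial.induction_on' q add fun n a => by
    rw [← LaurentPolynomial.single_eq_C_mul_T]; exact single n a

open Classical in
theorem coef_cyclicHom (T : X ≃ₜ X) {p : ℕ} (hp : 0 < p) (q : LaurentPolynomial K) (k : ℤ) (x : X) :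
    coef T (cyclicHom K T p q) k x = if (p : ℤ) ∣ k then q.coeff (k / p) else 0 := by
  have hpz : (p : ℤ) ≠ 0 := by exact_mod_cast hp.ne'
  induction q using laurent_induction with
  | add q r hq hr =>
    rw [map_add, coef_add, LocallyConstant.coe_add, Pi.add_apply, hq, hr]
    split_ifs <;> simp
  | single n a =>
    rw [cyclicHom_single, coef_mono]
    by_cases h : (p : ℤ) * n = k
    · subst h
      rw [if_pos rfl, if_pos (dvd_mul_right _ _), Int.mul_ediv_cancel_left _ hpz,
        AddMonoidAlgebra.coeff_single, Finsupp.single_eq_same]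
      rfl
    · rw [if_neg h]
      split_ifs with h'
      · obtain ⟨l, rfl⟩ := h'
        have : n ≠ l := fun h' => h (by rw [h'])
        rw [Int.mul_ediv_cancel_left _ hpz, AddMonoidAlgebra.coeff_single,
          Finsupp.single_eq_of_ne' this]
        rfl
      · rfl

/-- The additive subgroup generated by the terms `f tᵏ` with `f` vanishing on the orbit of `x`. -/
def orbitNull (K : Type*) [Field K] (T : X ≃ₜ X) (x : X) : AddSubgroup (DynCrossedProduct K T) :=
  AddSubgroup.closure {a | ∃ (f : LocallyConstant X K) (k : ℤ),
    (∀ m : ℤ, f ((T ^ m : X ≃ₜ X) x) = 0) ∧ a = mono T f k}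

theorem mono_mem_orbitNull {T : X ≃ₜ X} {x : X} {f : LocallyConstant X K}
    (hf : ∀ m : ℤ, f ((T ^ m : X ≃ₜ X) x) = 0) (k : ℤ) : mono T f k ∈ orbitNull K T x :=
  AddSubgroup.subset_closure ⟨f, k, hf, rfl⟩

/-- The rank of `f tᵏ` is at most the measure of the support of `f`, which is null when `f` vanishes
on the orbit. -/
theorem IsSylvesterRank.eltRank_eq_zero_of_mem_orbitNull [MeasurableSpace X] {T : X ≃ₜ X} {x : X}
    {μ : Measure X} (hμ : μ {y | ∀ k : ℤ, y ≠ (T ^ k : X ≃ₜ X) x} = 0)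
    {rk : MatrixFunction (DynCrossedProduct K T)} (h : IsSylvesterRank rk)
    (hU : ∀ (U : Set X) (hU : IsClopen U), eltRank rk (chi K T hU) = μ.real U)
    {a : DynCrossedProduct K T} (ha : a ∈ orbitNull K T x) : eltRank rk a = 0 := by
  induction ha using AddSubgroup.closure_induction with
  | mem a ha =>
    obtain ⟨f, k, hf, rfl⟩ := ha
    refine le_antisymm ((h.eltRank_mono_le f k).trans ?_) (h.eltRank_nonneg _)
    rw [hU, measureReal_def, measure_mono_null ?_ hμ, ENNReal.toReal_zero]
    rintro y hy k rfl
    exact hy (hf k)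
  | zero => exact h.eltRank_zero
  | add a b _ _ ha hb =>
    exact le_antisymm ((h.eltRank_add_le a b).trans (by rw [ha, hb, add_zero])) (h.eltRank_nonneg _)
  | neg a _ ha => rw [h.eltRank_neg, ha]

section Cut

variable {T : X ≃ₜ X} {x : X} {p : ℕ} {h : LocallyConstant X ℕ}

open Classical in
-- On the orbit, level `l` consists of the points `Tᵐx` with `m ≡ l` modulo `p`, and the bottom
-- level is just `x`. A cut monomial therefore survives only if its exponent is divisible by `p`,
-- and only one value of `g` matters.
theorem cut_mono_sub_mem_orbitNull (hp0 : 0 < p)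
    (hp : ∀ k : ℤ, (T ^ k : X ≃ₜ X) x = x ↔ (p : ℤ) ∣ k)
    (hh : ∀ k : ℤ, h ((T ^ k : X ≃ₜ X) x) = (k % p).toNat) (i j : Fin p)
    (g : LocallyConstant X K) (k : ℤ) :
    cutLeft K T h i * mono T g k * cutRight K T h j -
      (if (p : ℤ) ∣ k + j - i then
        mono T (levelFn K h 0 * LocallyConstant.const X (g ((T ^ (i : ℤ) : X ≃ₜ X) x))) (k + j - i)
      else 0) ∈ orbitNull K T x := by
  have hpz : (0 : ℤ) < p := by exact_mod_cast hp0
  have hlev : ∀ (l : Fin p) (m : ℤ), levelFn K h l ((T ^ m : X ≃ₜ X) x) =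
      if (p : ℤ) ∣ m - l then 1 else 0 := by
    intro l m
    have h1 : 0 ≤ m % p := Int.emod_nonneg _ hpz.ne'
    rw [levelFn_apply, hh]
    refine if_congr ?_ rfl rfl
    have h2 : (l : ℤ) % p = l := Int.emod_eq_of_lt (by positivity) (by exact_mod_cast l.2)
    rw [Int.dvd_iff_emod_eq_zero, ← Int.emod_eq_emod_iff_emod_sub_eq_zero, h2]
    omega
  have hlev0 : ∀ m : ℤ, levelFn K h 0 ((T ^ m : X ≃ₜ X) x) = if (p : ℤ) ∣ m then 1 else 0 :=
    fun m => by simpa using hlev ⟨0, hp0⟩ m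
  rw [cutLeft_mul_mono_mul_cutRight]
  split_ifs with hd
  · rw [← mono_sub]
    refine mono_mem_orbitNull (fun m => ?_) _
    simp only [LocallyConstant.coe_sub, Pi.sub_apply, LocallyConstant.coe_mul, Pi.mul_apply,
      shift_apply, neg_neg, ← zpow_add_apply, hlev, hlev0, LocallyConstant.coe_const,
      Function.const_apply, add_sub_cancel_left]
    split_ifs with h1 h2 h2
    · have : (T ^ ((i : ℤ) + m) : X ≃ₜ X) x = (T ^ (i : ℤ) : X ≃ₜ X) x := by
        rw [zpow_add_apply, (hp m).2 h1]
      rw [this]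
      ring
    · exact absurd ((dvd_sub h1 hd).trans (dvd_of_eq (by ring))) h2
    · ring
    · ring
  · rw [sub_zero]
    refine mono_mem_orbitNull (fun m => ?_) _
    simp only [LocallyConstant.coe_mul, Pi.mul_apply, shift_apply, neg_neg, ← zpow_add_apply, hlev,
      add_sub_cancel_left]
    split_ifs with h1 h2 h2
    · exact absurd ((dvd_sub h1 h2).trans (dvd_of_eq (by ring))) hd
    · ring
    · ring
    · ring

theorem levelFn_mul_cyclicHom_single (n : ℤ) (a : K) :
    mono T (levelFn K h 0) 0 * cyclicHom K T p (AddMonoidAlgebra.single n a) =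
      mono T (levelFn K h 0 * LocallyConstant.const X a) (p * n) := by
  rw [cyclicHom_single, mono_mul_mono, zero_add]
  congr 1

theorem exists_cut_sub_mem_orbitNull (hp0 : 0 < p)
    (hp : ∀ k : ℤ, (T ^ k : X ≃ₜ X) x = x ↔ (p : ℤ) ∣ k)
    (hh : ∀ k : ℤ, h ((T ^ k : X ≃ₜ X) x) = (k % p).toNat) (i j : Fin p)
    (a : DynCrossedProduct K T) : ∃ q : LaurentPolynomial K,
      cutLeft K T h i * a * cutRight K T h j - mono T (levelFn K h 0) 0 * cyclicHom K T p q ∈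
        orbitNull K T x := by
  classical
  induction a using crossed_induction with
  | zero => exact ⟨0, by simp [zero_mem]⟩
  | add a b ha hb =>
    obtain ⟨q, hq⟩ := ha
    obtain ⟨r, hr⟩ := hb
    refine ⟨q + r, ?_⟩
    have := add_mem hq hr
    rw [map_add, mul_add, mul_add, add_mul]
    rwa [add_sub_add_comm]
  | mono g k =>
    have := cut_mono_sub_mem_orbitNull hp0 hp hh i j g k
    split_ifs at this with hd
    · obtain ⟨n, hn⟩ := hd
      refine ⟨AddMonoidAlgebra.single n (g ((T ^ (i : ℤ) : X ≃ₜ X) x)), ?_⟩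
      rwa [levelFn_mul_cyclicHom_single, ← hn]
    · exact ⟨0, by simpa using this⟩

/-- Powers of `tᵖ` preserve every level on the orbit, so cutting yields a diagonal matrix of `p`
equal corners; hence the factor `p` in `exists_fval_eq_fval_cyclicHom`. -/
theorem cut_cyclicHom_sub_mem_orbitNull (hp0 : 0 < p)
    (hp : ∀ k : ℤ, (T ^ k : X ≃ₜ X) x = x ↔ (p : ℤ) ∣ k)
    (hh : ∀ k : ℤ, h ((T ^ k : X ≃ₜ X) x) = (k % p).toNat) (i j : Fin p) (q : LaurentPolynomial K) :
    cutLeft K T h i * cyclicHom K T p q * cutRight K T h j -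
      (if i = j then mono T (levelFn K h 0) 0 * cyclicHom K T p q else 0) ∈ orbitNull K T x := by
  classical
  induction q using laurent_induction with
  | add q r hq hr =>
    have := add_mem hq hr
    rw [map_add, mul_add, mul_add, add_mul]
    split_ifs at this ⊢
    · rwa [add_sub_add_comm]
    · simpa only [sub_zero] using this
  | single n a =>
    have := cut_mono_sub_mem_orbitNull hp0 hp hh i j (LocallyConstant.const X a) (p * n)
    rw [levelFn_mul_cyclicHom_single, cyclicHom_single]
    have hij : (p : ℤ) ∣ p * n + j - i ↔ i = j := by
      rw [add_sub_assoc, dvd_add_right (dvd_mul_right _ _)]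
      refine ⟨fun hd => ?_, fun hd => by simp [hd]⟩
      have h0 := Int.eq_zero_of_abs_lt_dvd hd (by rw [abs_lt]; omega)
      exact Fin.ext (by omega)
    by_cases h1 : i = j
    · subst h1
      rw [if_pos (hij.2 rfl), add_sub_cancel_right] at this
      rwa [if_pos rfl]
    · rw [if_neg (mt hij.1 h1)] at this
      rwa [if_neg h1]

variable [MeasurableSpace X]

/-- Over a periodic orbit of length `p`, the rank of a matrix is computed by a matrix over
`K[t, t⁻¹]`. -/
theorem exists_fval_eq_fval_cyclicHom {μ : Measure X}
    (hμ : μ {y | ∀ k : ℤ, y ≠ (T ^ k : X ≃ₜ X) x} = 0) (hp0 : 0 < p)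
    (hp : ∀ k : ℤ, (T ^ k : X ≃ₜ X) x = x ↔ (p : ℤ) ∣ k)
    (hh : ∀ k : ℤ, h ((T ^ k : X ≃ₜ X) x) = (k % p).toNat) {m n : ℕ}
    (M : Matrix (Fin m) (Fin n) (DynCrossedProduct K T)) :
    ∃ P : Matrix (Fin m × Fin p) (Fin n × Fin p) (LaurentPolynomial K),
      ∀ rk : MatrixFunction (DynCrossedProduct K T), IsSylvesterRank rk →
        (∀ (U : Set X) (hU : IsClopen U), eltRank rk (chi K T hU) = μ.real U) →
        fval rk (P.map (cyclicHom K T p)) = p * rk m n M := by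
  classical
  choose q hq using fun (a : DynCrossedProduct K T) (i j : Fin p) =>
    exists_cut_sub_mem_orbitNull hp0 hp hh i j a
  refine ⟨Matrix.of fun a b => q (M a.1 b.1) a.2 b.2, fun rk hrk hU => ?_⟩
  have hnull : ∀ a ∈ orbitNull K T x, eltRank rk a = 0 := fun a ha =>
    hrk.eltRank_eq_zero_of_mem_orbitNull hμ hU ha
  -- Heights of `p` or more may occur off the orbit, so the first `p` levels sum to 1 only modulo
  -- `orbitNull`.
  have hu : eltRank rk (∑ i : Fin p, cutRight K T h i * cutLeft K T h i - 1) = 0 := by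
    refine hnull _ ?_
    have hpz : (0 : ℤ) < p := by exact_mod_cast hp0
    simp only [cutRight_mul_cutLeft, chi]
    rw [← map_sum, ← map_one (CrossedProduct.incl (homeoAutomorphism K T)), ← map_sub,
      incl_eq_mono]
    refine mono_mem_orbitNull (fun k => ?_) _
    have h1 : 0 ≤ k % p := Int.emod_nonneg _ hpz.ne'
    have h2 : k % p < p := Int.emod_lt_of_pos _ hpz
    have h3 : ∀ i : Fin p, LocallyConstant.charFn K (isClopen_levelSet h i)
        ((T ^ k : X ≃ₜ X) x) = if (⟨(k % p).toNat, by omega⟩ : Fin p) = i then 1 else 0 := by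
      intro i
      have := levelFn_apply (K := K) h i ((T ^ k : X ≃ₜ X) x)
      rw [levelFn] at this
      rw [this, hh]
      simp [Fin.ext_iff]
    rw [LocallyConstant.coe_sub, Pi.sub_apply, ← LocallyConstant.coeFnRingHom_apply, map_sum,
      Finset.sum_apply]
    simp [h3]
  -- Cut both sides: modulo `orbitNull` the matrix `M` becomes `E`, and the Laurent matrix becomes
  -- `p` diagonal copies of `E`.
  rw [← hrk.fval_fin, ← hrk.fval_cut (fun i : Fin p => cutLeft K T h i)
    (fun i : Fin p => cutRight K T h i) hu, ← hrk.fval_cut (fun i : Fin p => cutLeft K T h i)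
    (fun i : Fin p => cutRight K T h i) hu M]
  set E : Matrix (Fin m × Fin p) (Fin n × Fin p) (DynCrossedProduct K T) :=
    Matrix.of fun a b => mono T (levelFn K h 0) 0 * cyclicHom K T p (q (M a.1 b.1) a.2 b.2) with hE
  have h1 := hrk.fval_congr_of_eltRank_sub
    (M := Matrix.of fun (a : Fin m × Fin p) (b : Fin n × Fin p) =>
      cutLeft K T h a.2 * M a.1 b.1 * cutRight K T h b.2) (N := E)
    fun a b => hnull _ (hq (M a.1 b.1) a.2 b.2)
  rw [h1]
  have h2 := hrk.fval_blockDiagonal fun _ : Fin p => E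
  rw [Finset.sum_const, Finset.card_univ, Fintype.card_fin, nsmul_eq_mul] at h2
  rw [← h2]
  refine hrk.fval_congr_of_eltRank_sub fun a b => hnull _ ?_
  exact cut_cyclicHom_sub_mem_orbitNull hp0 hp hh a.2 b.2 _

theorem rank_unique_of_periodic {μ : Measure X}
    (hμ : μ {y | ∀ k : ℤ, y ≠ (T ^ k : X ≃ₜ X) x} = 0) (hp0 : 0 < p)
    (hp : ∀ k : ℤ, (T ^ k : X ≃ₜ X) x = x ↔ (p : ℤ) ∣ k)
    (hh : ∀ k : ℤ, h ((T ^ k : X ≃ₜ X) x) = (k % p).toNat)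
    {rk rk' : MatrixFunction (DynCrossedProduct K T)} (hrk : IsSylvesterRank rk)
    (hrk' : IsSylvesterRank rk')
    (hU : ∀ (U : Set X) (hU : IsClopen U), eltRank rk (chi K T hU) = μ.real U)
    (hU' : ∀ (U : Set X) (hU : IsClopen U), eltRank rk' (chi K T hU) = μ.real U)
    (hd : ∀ d : LaurentPolynomial K, d ≠ 0 → eltRank rk (cyclicHom K T p d) = 1)
    (hd' : ∀ d : LaurentPolynomial K, d ≠ 0 → eltRank rk' (cyclicHom K T p d) = 1) : rk = rk' := by
  have h1 := (hrk.pullback (cyclicHom K T p)).ext_domain (hrk'.pullback (cyclicHom K T p))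
    (fun d h0 => by rw [IsSylvesterRank.eltRank_pullback, hd d h0])
    (fun d h0 => by rw [IsSylvesterRank.eltRank_pullback, hd' d h0])
  funext m n M
  obtain ⟨P, hP⟩ := exists_fval_eq_fval_cyclicHom hμ hp0 hp hh M
  have h2 : (p : ℝ) * rk m n M = p * rk' m n M := by
    rw [← hP rk hrk hU, ← hP rk' hrk' hU', ← IsSylvesterRank.fval_pullback rk,
      ← IsSylvesterRank.fval_pullback rk', h1]
  exact mul_left_cancel₀ (by positivity) h2

end Cut

section Full

variable [CompactSpace X] [MeasurableSpace X] [BorelSpace X] (T : X ≃ₜ X)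

/-- A nonzero Laurent polynomial in `tᵖ` has full rank. -/
theorem eltRank_measureRank_cyclicHom (μ : Measure X) [IsProbabilityMeasure μ] {p : ℕ} (hp : 0 < p)
    {d : LaurentPolynomial K} (hd : d ≠ 0) :
    eltRank (measureRank T μ) (cyclicHom K T p d) = 1 := by
  classical
  have hS := (measureRank_mem_regularSylvesterRanks (K := K) T μ).1
  refine le_antisymm (hS.eltRank_le_one _) ?_
  have hne : d.coeff.support.Nonempty := by
    rw [Finsupp.support_nonempty_iff]
    exact fun h => hd (LaurentPolynomial.ext fun n => by rw [h]; rfl)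
  set v := d.coeff.support.min' hne with hv
  -- Shift the lowest exponent to 0. All compressions are then lower triangular with the nonzero
  -- lowest coefficient on the diagonal, hence invertible.
  set d' : LaurentPolynomial K := LaurentPolynomial.T (-v) * d with hd'
  have hcoeff : ∀ n, d'.coeff n = d.coeff (n + v) := fun n => by
    rw [hd', LaurentPolynomial.T, AddMonoidAlgebra.coeff_single_mul_eq_mul_coeff (n + v), one_mul]
    intro m _
    constructor <;> intro <;> omega
  have hle : eltRank (measureRank T μ) (cyclicHom K T p d') ≤
      eltRank (measureRank T μ) (cyclicHom K T p d) := by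
    rw [hd', map_mul]
    exact hS.eltRank_mul_le_right _ _
  refine le_trans (le_of_eq ?_) hle
  rw [eltRank_measureRank]
  refine (ultralimit_eq (isSylvesterRank_levelRank μ) ?_).symm
  have hfull : ∀ N, levelRank K μ N 1 1 !![compress T (cyclicHom K T p d')] = 1 := by
    intro N
    change eltRank (levelRank K μ N) _ = _
    rw [eltRank_levelRank]
    have hrank : ∀ x, (compress T (cyclicHom K T p d') N x).rank = N + 1 := by
      intro x
      have htri : (compress T (cyclicHom K T p d') N x).BlockTriangular OrderDual.toDual := by
        intro i j hij
        have hij' : i < j := hij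
        rw [compress_apply, coef_cyclicHom T hp]
        split_ifs with hdvd
        · rw [hcoeff]
          by_contra hcon
          have h1 := d.coeff.support.min'_le _ (Finsupp.mem_support_iff.2 hcon)
          have h2 : ((i : ℤ) - j) / p < 0 :=
            Int.ediv_neg_of_neg_of_pos (by have : (i : ℕ) < j := hij'; omega) (by exact_mod_cast hp)
          omega
        · rfl
      have hunit : IsUnit (compress T (cyclicHom K T p d') N x) := by
        rw [Matrix.isUnit_iff_isUnit_det, Matrix.det_of_isLowerTriangular _ htri, isUnit_iff_ne_zero,
          Finset.prod_ne_zero_iff]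
        intro i _
        rw [compress_apply, coef_cyclicHom T hp]
        simp only [sub_self, dvd_zero, if_true, Int.zero_ediv, hcoeff, zero_add]
        exact Finsupp.mem_support_iff.1 (d.coeff.support.min'_mem hne)
      rw [Matrix.rank_of_isUnit _ hunit, Fintype.card_fin]
    simp only [hrank]
    have : (N : ℝ) + 1 ≠ 0 := by positivity
    simp [this]
  simp only [hfull]
  exact tendsto_const_nhds

end Full

end Periodic

end

/-! ### Uniqueness for ergodic measures and extremality -/

/-- Since 1 is the largest rank of an element, a proper convex combination attains it only if both
terms do. -/
theorem IsSylvesterRank.eq_one_of_mem_openSegment {R : Type*} [Ring R]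
    {rk₁ rk₂ rk : MatrixFunction R} (h₁ : IsSylvesterRank rk₁) (h₂ : IsSylvesterRank rk₂)
    (hrk : rk ∈ openSegment ℝ rk₁ rk₂) {a : R} (ha : eltRank rk a = 1) :
    eltRank rk₁ a = 1 ∧ eltRank rk₂ a = 1 := by
  obtain ⟨s, t, hs, ht, hst, rfl⟩ := hrk
  have h3 : s * eltRank rk₁ a + t * eltRank rk₂ a = 1 := ha
  have h4 := h₁.eltRank_le_one a
  have h5 := h₂.eltRank_le_one a
  constructor
  · by_contra hne
    have := mul_lt_mul_of_pos_left (lt_of_le_of_ne h4 hne) hs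
    have := mul_le_mul_of_nonneg_left h5 ht.le
    linarith
  · by_contra hne
    have := mul_lt_mul_of_pos_left (lt_of_le_of_ne h5 hne) ht
    have := mul_le_mul_of_nonneg_left h4 hs.le
    linarith

/-- A rank function inducing an ergodic measure is determined by this measure and by its values on
the Laurent polynomials in powers of `t`. -/
theorem rank_unique_of_ergodic {K : Type*} [Field K] {X : Type*} [TopologicalSpace X]
    [CompactSpace X] [TopologicalSpace.MetrizableSpace X] [TotallyDisconnectedSpace X]
    [MeasurableSpace X] [BorelSpace X] {T : X ≃ₜ X} {μ : Measure X} [IsProbabilityMeasure μ]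
    (hT : Ergodic T μ) {rk rk' : MatrixFunction (DynCrossedProduct K T)} (hrk : IsSylvesterRank rk)
    (hrk' : IsSylvesterRank rk')
    (hU : ∀ (U : Set X) (hU : IsClopen U), eltRank rk (chi K T hU) = μ.real U)
    (hU' : ∀ (U : Set X) (hU : IsClopen U), eltRank rk' (chi K T hU) = μ.real U)
    (hd : ∀ (p : ℕ) (d : LaurentPolynomial K), 0 < p → d ≠ 0 →
      eltRank rk (cyclicHom K T p d) = 1)
    (hd' : ∀ (p : ℕ) (d : LaurentPolynomial K), 0 < p → d ≠ 0 →
      eltRank rk' (cyclicHom K T p d) = 1) : rk = rk' := by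
  let := TopologicalSpace.metrizableSpaceMetric X
  -- A point of the support of `μ`: either it has measure zero and small neighbourhoods serve as
  -- bases of towers, or it is an atom and `μ` lives on its finite orbit.
  obtain ⟨x, -, hx⟩ := exists_mem_forall_mem_nhdsWithin_pos_measure (μ := μ) (s := Set.univ)
    (by simp)
  rw [nhdsWithin_univ] at hx
  by_cases h0 : μ {x} = 0
  · exact rank_unique_of_small_sections hT.toMeasurePreserving
      (fun ε hε => exists_small_height hT hx h0 hε) hrk hrk' hU hU'
  · obtain ⟨p, hp0, hp⟩ := exists_period hT.toMeasurePreserving h0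
    obtain ⟨h, -, hh⟩ := exists_height_of_periodic hp0 hp
    exact rank_unique_of_periodic (measure_compl_orbit hT h0) hp0 hp hh hrk hrk' hU hU'
      (fun d => hd p d hp0) fun d => hd' p d hp0

theorem measureRank_mem_extremePoints {K : Type*} [Field K] {X : Type*} [TopologicalSpace X]
    [CompactSpace X] [TopologicalSpace.MetrizableSpace X] [TotallyDisconnectedSpace X]
    [MeasurableSpace X] [BorelSpace X] (T : X ≃ₜ X) (μ : Measure X)
    (hμ : μ ∈ Set.extremePoints ℝ≥0∞ (invariantProbabilityMeasures T)) :
    measureRank T μ ∈ Set.extremePoints ℝ (sylvesterRanks (DynCrossedProduct K T)) := by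
  let := TopologicalSpace.metrizableSpaceMetric X
  have hprob : IsProbabilityMeasure μ := hμ.1.2
  have hT : Ergodic T μ := Ergodic.of_mem_extremePoints hμ
  refine ⟨(measureRank_mem_regularSylvesterRanks (K := K) T μ).1, fun rk₁ h₁ rk₂ h₂ hmem => ?_⟩
  have hchi : ∀ (U : Set X) (hU : IsClopen U), eltRank rk₁ (chi K T hU) = μ.real U ∧
      eltRank rk₂ (chi K T hU) = μ.real U := by
    obtain ⟨s, t, hs, ht, hst, heq⟩ := hmem
    have H : ∀ (U : Set X) (hU : IsClopen U),
        s * eltRank rk₁ (chi K T hU) + t * eltRank rk₂ (chi K T hU) = μ.real U := by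
      intro U hU
      rw [← measureRank_chi (K := K) T hμ.1.1 hU, ← heq]
      rfl
    exact fun U hU => ⟨IsSylvesterRank.eltRank_chi_eq_of_extremePoint h₁ h₂ hμ hs ht hst H hU,
      IsSylvesterRank.eltRank_chi_eq_of_extremePoint h₂ h₁ hμ ht hs (by rw [add_comm, hst])
        (fun U hU => by rw [add_comm, H U hU]) hU⟩
  have hfull : ∀ (p : ℕ) (d : LaurentPolynomial K), 0 < p → d ≠ 0 →
      eltRank rk₁ (cyclicHom K T p d) = 1 ∧ eltRank rk₂ (cyclicHom K T p d) = 1 :=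
    fun p d hp hd => IsSylvesterRank.eq_one_of_mem_openSegment h₁ h₂ hmem
      (eltRank_measureRank_cyclicHom T μ hp hd)
  have h12 : rk₁ = rk₂ := rank_unique_of_ergodic hT h₁ h₂ (fun U hU => (hchi U hU).1)
    (fun U hU => (hchi U hU).2) (fun p d hp hd => (hfull p d hp hd).1)
    fun p d hp hd => (hfull p d hp hd).2
  subst h12
  rw [openSegment_same] at hmem
  exact hmem.symm

theorem proposition5p2 {K : Type*} [Field K] {X : Type*} [TopologicalSpace X] [CompactSpace X]
    [TopologicalSpace.MetrizableSpace X] [TotallyDisconnectedSpace X] [MeasurableSpace X]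
    [BorelSpace X] (T : X ≃ₜ X) (μ : Measure X)
    (hμ : μ ∈ Set.extremePoints ℝ≥0∞ (invariantProbabilityMeasures T)) :
    ∃ rk ∈ Set.extremePoints ℝ (sylvesterRanks (DynCrossedProduct K T)) ∩
        regularSylvesterRanks (DynCrossedProduct K T),
      ∀ (U : Set X) (hU : IsClopen U), rk 1 1 !![chi K T hU] = μ.real U := by
  have hprob : IsProbabilityMeasure μ := hμ.1.2
  exact ⟨measureRank T μ, ⟨measureRank_mem_extremePoints T μ hμ,
    measureRank_mem_regularSylvesterRanks T μ⟩, fun U hU => measureRank_chi T hμ.1.1 hU⟩
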